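/- **Conventions.** For $d\ge 1$ let $\mathcal P_d(\mathbb R)$ be the set of monic real-rooted polynomials of degree $d$. Write a monic polynomial of degree $d$ as $p(x)=\sum_{k=0}^d x^{d-k}(-1)^k\binom dk \tilde a_k(p)$. The finite free multiplicative convolution is $[p\boxtimes_d q](x)=\sum_{k=0}^d x^{d-k}(-1)^k\binom dk\,\tilde a_k(p)\tilde a_k(q)$; the finite free cumulants are $$\kappa_n(p)=\frac{(-d)^{n-1}}{(n-1)!}\sum_{\pi\in P(n)}(-1)^{|\pi|-1}(|\pi|-1)!\prod_{V\in\pi}\tilde a_{|V|}(p)\qquad(1\le n\le d),$$ with $P(n)$ the set of partitions of $[n]=\{1,\dots,n\}$; and $m_n(p)=\frac1d\sum_{i=1}^d\lambda_i^n$, where $\lambda_1,\dots,\lambda_d$ are the complex roots of $p$ with multiplicity. For a sequence $u=(u_n)_{n\ge1}$ and a partition $\pi$ put $u_\pi=\prod_{V\in\pi}u_{|V|}$ and $u_{\pi\setminus V}=\prod_{W\in\pi,W\ne V}u_{|W|}$; for a permutation $\sigma$, $u_\sigma$ is the product of $u_{|c|}$ over its cycles $c$ (fixed points included). $NC(n)$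 is the set of non-crossing partitions of $[n]$. For $\pi\in NC(n)$, regarded also as the permutation whose cycles are its blocks in increasing order, $Kr(\pi)$ is the partition of $[n]$ into cycles of $\pi^{-1}\gamma_n$, $\gamma_n=(1,2,\dots,n)$. For $t,s\ge1$ let $\gamma_{t,s}=(1,\dots,t)(t+1,\dots,t+s)$, let $S_{NC}(t,s)$ be the set of $\sigma\in S_{t+s}$ such that $\langle\sigma,\gamma_{t,s}\rangle$ is transitive on $[t+s]$ and the numbers of cycles of $\sigma$ and $\sigma^{-1}\gamma_{t,s}$ add up to $t+s$, and put $Kr_{t,s}(\sigma)=\sigma^{-1}\gamma_{t,s}$. The free cumulants $r_n(\mu)$ of a moment sequence $(m_n(\mu))$ are determined by $m_n(\mu)=\sum_{\pi\in NC(n)}r_\pi(\mu)$, $n\ge1$. The free multiplicative convolution $\mu\boxtimes\nu$ is the distribution (moment sequence) with free cumulants $r_n(\mu\boxtimes\nu)=\sum_{\pi\in NC(n)}r_\pi(\mu)\,r_{Kr(\pi)}(\nu)$, $n\ge 1$. A sequence $\mathfrak p=(p_d)_{d\ge1}$ with $p_d$ monic of degree $d$ has infinitesimal distribution $(\mu,\mu')$,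 where $\mu$ is a probability measure on $\mathbb R$ with finite moments $m_n(\mu)$ of all orders and $\mu':\mathbb R[x]\to\mathbb R$ is linear, if $m_n(p_d)\to m_n(\mu)$ and $d\,(m_n(p_d)-m_n(\mu))\to\mu'(x^n)$ as $d\to\infty$ for all $n\ge0$. Its cumulant fluctuations are the numbers $\widehat r_n(\mathfrak p)$, $n\ge1$, with $\kappa_n(p_d)=r_n(\mu)+\frac1d\widehat r_n(\mathfrak p)+o(1/d)$. **Theorem.** Let $\mathfrak p=(p_d)_{d\ge1}$ and $\mathfrak q=(q_d)_{d\ge1}$ with $p_d,q_d\in\mathcal P_d(\mathbb R)$ have infinitesimal distributions $(\mu,\mu')$ and $(\nu,\nu')$. Then the cumulant fluctuations $\widehat r_n(\mathfrak p)$ and $\widehat r_n(\mathfrak q)$ exist, and for every $n\ge1$, as $d\to\infty$, $$\kappa_n(p_d\boxtimes_d q_d)=r_n(\mu\boxtimes\nu)+\frac1d\,\widehat r_n(\mathfrak p\boxtimes\mathfrak q)+o(1/d),$$ where $$\widehat r_n(\mathfrak p\boxtimes\mathfrak q)=\sum_{\pi\in NC(n)}\Big(\sum_{V\in\pi}\widehat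 r_{|V|}(\mathfrak p)\,r_{\pi\setminus V}(\mu)\,r_{Kr(\pi)}(\nu)+\sum_{W\in Kr(\pi)}r_\pi(\mu)\,\widehat r_{|W|}(\mathfrak q)\,r_{Kr(\pi)\setminus W}(\nu)\Big)-\frac n2\sum_{\substack{t+s=n,\ t,s\ge1\\ \sigma\in S_{NC}(t,s)}}\frac{r_\sigma(\mu)\,r_{Kr_{t,s}(\sigma)}(\nu)}{ts}.$$ Consequently $\mathfrak p\boxtimes\mathfrak q=(p_d\boxtimes_d q_d)_{d\ge1}$ has infinitesimal moments of all orders: for every $n\ge1$, $$\lim_{d\to\infty}d\,\big(m_n(p_d\boxtimes_d q_d)-m_n(\mu\boxtimes\nu)\big)=\sum_{\pi\in NC(n)}\sum_{V\in\pi}\widehat r_{|V|}(\mathfrak p\boxtimes\mathfrak q)\,r_{\pi\setminus V}(\mu\boxtimes\nu)-\frac n2\sum_{\substack{t+s=n,\ t,s\ge1\\ \sigma\in S_{NC}(t,s)}}\frac{r_\sigma(\mu\boxtimes\nu)}{ts}.$$ In particular, whenever a probability measure $\tau$ on $\mathbb R$ with finite moments of all orders satisfies $r_n(\tau)=r_n(\mu\boxtimes\nu)$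 for all $n\ge1$, the sequence $\mathfrak p\boxtimes\mathfrak q$ has infinitesimal distribution $(\tau,\tau')$, with $\tau'(x^n)$ equal to the limit above for $n\ge 1$, and its cumulant fluctuations are the $\widehat r_n(\mathfrak p\boxtimes\mathfrak q)$. -/

import Mathlib

open Polynomial MeasureTheory Filter Topology
open scoped BigOperators

namespace FiniteFree

/-! ### Non-crossing partitions, Kreweras complements, annular non-crossing permutations -/

/-- Set partitions of `{0, …, n-1}` (standing for `[n] = {1, …, n}`). -/
abbrev SetPartition (n : ℕ) : Type := Finpartition (Finset.univ : Finset (Fin n))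

/-- A partition is non-crossing if `a < b < c < d`, `a, c ∈ V`, `b, d ∈ W` force `V = W`. -/
def IsNonCrossing {n : ℕ} (π : SetPartition n) : Prop :=
  ∀ V ∈ π.parts, ∀ W ∈ π.parts, ∀ a b c d : Fin n,
    a < b → b < c → c < d → a ∈ V → c ∈ V → b ∈ W → d ∈ W → V = W

open Classical in
/-- `NC(n)`, the set of non-crossing partitions of `[n]`. -/
noncomputable def NC (n : ℕ) : Finset (SetPartition n) :=
  Finset.univ.filter IsNonCrossing

/-- The cyclic permutation whose only nontrivial cycle is `V` written in increasing order. -/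
def blockCycle {n : ℕ} (V : Finset (Fin n)) : Equiv.Perm (Fin n) :=
  (V.sort (· ≤ ·)).formPerm

theorem blockCycle_mem {n : ℕ} {V : Finset (Fin n)} {a : Fin n} (h : a ∈ V) :
    blockCycle V a ∈ V := by
  have h2 : blockCycle V a ∈ V.sort (· ≤ ·) :=
    List.formPerm_apply_mem_of_mem (by simpa using h)
  simpa only [Finset.mem_sort] using h2

theorem blockCycle_symm_mem {n : ℕ} {V : Finset (Fin n)} {a : Fin n} (h : a ∈ V) :
    (blockCycle V).symm a ∈ V := by
  have h2 : (V.sort (· ≤ ·)).formPerm ((blockCycle V).symm a) ∈ V.sort (· ≤ ·) := by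
    simpa [blockCycle] using h
  simpa using List.mem_of_formPerm_apply_mem h2

theorem part_eq_of_mem_part {n : ℕ} (π : SetPartition n) {a b : Fin n} (h : b ∈ π.part a) :
    π.part b = π.part a :=
  π.part_eq_of_mem (π.part_mem.2 (Finset.mem_univ a)) h

/-- The permutation attached to a partition: its cycles are the blocks, each written in
increasing order. -/
def toPerm {n : ℕ} (π : SetPartition n) : Equiv.Perm (Fin n) where
  toFun a := blockCycle (π.part a) a
  invFun a := (blockCycle (π.part a)).symm a
  left_inv a := by
    have h := blockCycle_mem (π.mem_part (Finset.mem_univ a))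
    simp only [part_eq_of_mem_part π h, Equiv.symm_apply_apply]
  right_inv a := by
    have h := blockCycle_symm_mem (π.mem_part (Finset.mem_univ a))
    simp only [part_eq_of_mem_part π h, Equiv.apply_symm_apply]

open Classical in
/-- The partition attached to a permutation: its blocks are the cycles (orbits), fixed points
included. -/
noncomputable def cyclePartition {n : ℕ} (σ : Equiv.Perm (Fin n)) : SetPartition n :=
  Finpartition.ofSetoid (Equiv.Perm.SameCycle.setoid σ)

/-- The Kreweras complement `Kr(π)`: the partition of the permutation `π⁻¹ γ_n`, where
`γ_n = (1, 2, …, n)`. -/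
noncomputable def kreweras {n : ℕ} (π : SetPartition n) : SetPartition n :=
  cyclePartition ((toPerm π)⁻¹ * finRotate n)

/-- `γ_{t,s} = (1, …, t)(t+1, …, t+s)`. -/
def annularCycle (t s : ℕ) : Equiv.Perm (Fin (t + s)) :=
  finSumFinEquiv.permCongr (Equiv.sumCongr (finRotate t) (finRotate s))

open Classical in
/-- `S_NC(t,s)`, the annular non-crossing permutations: the group generated by `σ` and `γ_{t,s}`
acts transitively, and `|σ| + |σ⁻¹ γ_{t,s}| = t + s`, where `|·|` is the number of cycles. -/
noncomputable def annularNC (t s : ℕ) : Finset (Equiv.Perm (Fin (t + s))) :=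
  Finset.univ.filter fun σ =>
    MulAction.IsPretransitive
      (Subgroup.closure ({σ, annularCycle t s} : Set (Equiv.Perm (Fin (t + s))))) (Fin (t + s)) ∧
    (cyclePartition σ).parts.card + (cyclePartition (σ⁻¹ * annularCycle t s)).parts.card = t + s

/-- `u_π = ∏_{V ∈ π} u_{|V|}`. -/
def prodOver (u : ℕ → ℝ) {n : ℕ} (π : SetPartition n) : ℝ :=
  ∏ V ∈ π.parts, u V.card

/-- `∑_{V ∈ π} û_{|V|} u_{π ∖ V}`. -/
def derivOver (u u' : ℕ → ℝ) {n : ℕ} (π : SetPartition n) : ℝ :=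
  ∑ V ∈ π.parts, u' V.card * ∏ W ∈ π.parts.erase V, u W.card

/-- `(n/2) ∑_{t+s=n, t,s ≥ 1} ∑_{σ ∈ S_NC(t,s)} u_σ v_{Kr_{t,s}(σ)} / (ts)`, where
`Kr_{t,s}(σ) = σ⁻¹ γ_{t,s}`. -/
noncomputable def annularSum (u v : ℕ → ℝ) (n : ℕ) : ℝ :=
  (n : ℝ) / 2 *
    ∑ ts ∈ (Finset.HasAntidiagonal.antidiagonal n).filter (fun ts => 1 ≤ ts.1 ∧ 1 ≤ ts.2),
      ∑ σ ∈ annularNC ts.1 ts.2,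
        prodOver u (cyclePartition σ) *
          prodOver v (cyclePartition (σ⁻¹ * annularCycle ts.1 ts.2)) /
            ((ts.1 : ℝ) * (ts.2 : ℝ))

/-! ### Free cumulants and free multiplicative convolution -/

/-- The free cumulants `r_n` of a moment sequence `m`, through the recursion
`r_n = m_n - ∑_{π ∈ NC(n), π ≠ 1_n} r_π`: the summand of the one-block partition is `0` below.
The value at `n = 0` is irrelevant. -/
noncomputable def freeCumulant (m : ℕ → ℝ) (n : ℕ) : ℝ :=
  m n - ∑ π ∈ NC n, ∏ V ∈ π.parts, if V.card < n then freeCumulant m V.card else 0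

theorem card_lt_of_ne {n : ℕ} (hn : 1 ≤ n) (π : SetPartition n)
    (h : π ≠ Finpartition.indiscrete (Finset.univ_nonempty_iff.2 ⟨⟨0, hn⟩⟩).ne_empty) :
    ∀ V ∈ π.parts, V.card < n := by
  intro V hV
  by_contra hlt
  have hVu : V = Finset.univ := by
    apply Finset.eq_univ_of_card
    have := Finset.card_le_univ V
    simp only [Fintype.card_fin] at *
    omega
  apply h
  ext W
  simp only [Finpartition.indiscrete_parts, Finset.mem_singleton]
  constructor
  · intro hW
    obtain ⟨x, hx⟩ := π.nonempty_of_mem_parts hW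
    rw [← π.part_eq_of_mem hW hx]
    exact (π.part_eq_of_mem hV (by simp [hVu])).trans hVu
  · rintro rfl
    exact hVu ▸ hV

theorem sum_NC_split (u : ℕ → ℝ) {n : ℕ} (hn : 1 ≤ n) :
    ∑ π ∈ NC n, prodOver u π =
      u n + ∑ π ∈ NC n, ∏ V ∈ π.parts, if V.card < n then u V.card else 0 := by
  classical
  set I : SetPartition n :=
    Finpartition.indiscrete (Finset.univ_nonempty_iff.2 ⟨⟨0, hn⟩⟩).ne_empty with hI
  have hIparts : I.parts = {Finset.univ} := rfl
  have hmem : I ∈ NC n := by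
    simp only [NC, Finset.mem_filter, Finset.mem_univ, true_and]
    intro V hV W hW
    rw [hIparts, Finset.mem_singleton] at hV hW
    intros
    rw [hV, hW]
  rw [← Finset.add_sum_erase _ _ hmem, ← Finset.add_sum_erase (a := I) _ _ hmem]
  have h1 : prodOver u I = u n := by simp [prodOver, hIparts]
  have h2 : (∏ V ∈ I.parts, if V.card < n then u V.card else 0) = 0 := by simp [hIparts]
  rw [h1, h2, zero_add]
  congr 1
  refine Finset.sum_congr rfl fun π hπ => Finset.prod_congr rfl fun V hV => ?_
  rw [if_pos (card_lt_of_ne hn π (Finset.ne_of_mem_erase hπ) V hV)]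

/-- The moment-cumulant formula `m_n = ∑_{π ∈ NC(n)} r_π`. -/
theorem moment_eq_sum_freeCumulant (m : ℕ → ℝ) {n : ℕ} (hn : 1 ≤ n) :
    m n = ∑ π ∈ NC n, prodOver (freeCumulant m) π := by
  rw [sum_NC_split _ hn, freeCumulant]
  simp

/-- The moment-cumulant formula determines the free cumulants. -/
theorem freeCumulant_unique (m r : ℕ → ℝ)
    (h : ∀ n, 1 ≤ n → m n = ∑ π ∈ NC n, prodOver r π) :
    ∀ n, 1 ≤ n → r n = freeCumulant m n := by
  intro n
  induction n using Nat.strong_induction_on with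
  | _ n ih =>
    intro hn
    have e := h n hn
    rw [sum_NC_split _ hn] at e
    rw [freeCumulant, e, eq_comm, sub_eq_iff_eq_add]
    congr 1
    refine Finset.sum_congr rfl fun π _ => Finset.prod_congr rfl fun V hV => ?_
    by_cases hlt : V.card < n
    · rw [if_pos hlt, if_pos hlt]
      exact ih _ hlt (Finset.card_pos.2 (π.nonempty_of_mem_parts hV))
    · rw [if_neg hlt, if_neg hlt]

/-- `∑_{π ∈ NC(n)} r_π(μ) r_{Kr(π)}(ν)`, for moment sequences `m` of `μ` and `k` of `ν`. -/
noncomputable def freeMulConvCumulant (m k : ℕ → ℝ) (n : ℕ) : ℝ :=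
  ∑ π ∈ NC n, prodOver (freeCumulant m) π * prodOver (freeCumulant k) (kreweras π)

/-- The moment sequence of the free multiplicative convolution `μ ⊠ ν`, from the moment sequences
`m` of `μ` and `k` of `ν`: the one whose free cumulants are `freeMulConvCumulant m k`. -/
noncomputable def freeMulConv (m k : ℕ → ℝ) (n : ℕ) : ℝ :=
  ∑ π ∈ NC n, prodOver (freeMulConvCumulant m k) π

theorem freeCumulant_freeMulConv (m k : ℕ → ℝ) {n : ℕ} (hn : 1 ≤ n) :
    freeCumulant (freeMulConv m k) n = freeMulConvCumulant m k n :=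
  (freeCumulant_unique (freeMulConv m k) (freeMulConvCumulant m k) (fun _ _ => rfl) n hn).symm

/-- The moments `m_n(μ) = ∫ tⁿ dμ(t)`. -/
noncomputable def moments (μ : Measure ℝ) (n : ℕ) : ℝ := ∫ t, t ^ n ∂μ

/-- A probability measure on `ℝ` with finite moments of all orders. -/
def IsProbWithMoments (μ : Measure ℝ) : Prop :=
  IsProbabilityMeasure μ ∧ ∀ n : ℕ, Integrable (fun t : ℝ => t ^ n) μ

/-- The probability measure `τ` is a free multiplicative convolution `μ ⊠ ν`:
`r_n(τ) = ∑_{π ∈ NC(n)} r_π(μ) r_{Kr(π)}(ν)` for all `n ≥ 1`. -/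
def IsFreeMulConv (μ ν τ : Measure ℝ) : Prop :=
  IsProbWithMoments τ ∧
    ∀ n, 1 ≤ n → freeCumulant (moments τ) n = freeMulConvCumulant (moments μ) (moments ν) n

/-! ### Finite free probability -/

/-- `P_d(ℝ)`: monic real-rooted polynomials of degree `d`. -/
def IsRealRooted (d : ℕ) (p : ℝ[X]) : Prop :=
  p.Monic ∧ p.natDegree = d ∧ p.Splits

/-- The coefficients `ã_k` in `p = ∑_{k=0}^d x^{d-k} (-1)^k (d choose k) ã_k`, `0 ≤ k ≤ d`. -/
noncomputable def normCoeff (d : ℕ) (p : ℝ[X]) (k : ℕ) : ℝ :=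
  (-1) ^ k * p.coeff (d - k) / (d.choose k : ℝ)

/-- The finite free multiplicative convolution `p ⊠_d q`. -/
noncomputable def mulConv (d : ℕ) (p q : ℝ[X]) : ℝ[X] :=
  ∑ k ∈ Finset.range (d + 1),
    C ((-1) ^ k * (d.choose k : ℝ) * (normCoeff d p k * normCoeff d q k)) * X ^ (d - k)

/-- The finite free cumulants of a polynomial of degree `d`:
`κ_n(p) = (-d)^{n-1}/(n-1)! ∑_{π ∈ P(n)} (-1)^{|π|-1} (|π|-1)! ∏_{V ∈ π} ã_{|V|}(p)`, `1 ≤ n ≤ d`. -/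
noncomputable def finiteCumulant (d : ℕ) (p : ℝ[X]) (n : ℕ) : ℝ :=
  (-(d : ℝ)) ^ (n - 1) / ((n - 1).factorial : ℝ) *
    ∑ π : SetPartition n,
      (-1) ^ (π.parts.card - 1) * ((π.parts.card - 1).factorial : ℝ) * prodOver (normCoeff d p) π

/-- The `n`-th moment `(1/d) ∑ λⁿ` of the root distribution of a polynomial of degree `d`, the sum
being over the `d` complex roots with multiplicity (`p ⊠_d q` need not be real-rooted). This sum is
real, see `rootPowerSum_im`; for a real-rooted polynomial see `rootMoment_of_splits`. -/
noncomputable def rootMoment (d : ℕ) (p : ℝ[X]) (n : ℕ) : ℝ :=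
  ((p.aroots ℂ).map (fun z => z ^ n)).sum.re / (d : ℝ)

theorem rootMoment_of_splits (d : ℕ) {p : ℝ[X]} (hp : p.Splits) (n : ℕ) :
    rootMoment d p n = (p.roots.map (fun x => x ^ n)).sum / (d : ℝ) := by
  have h : p.aroots ℂ = p.roots.map (algebraMap ℝ ℂ) := hp.roots_map (algebraMap ℝ ℂ)
  have h2 : ((p.aroots ℂ).map (fun z => z ^ n)).sum
      = (((p.roots.map (fun x => x ^ n)).sum : ℝ) : ℂ) := by
    rw [h, Multiset.map_map]
    have := map_multiset_sum (algebraMap ℝ ℂ) (p.roots.map (fun x => x ^ n))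
    rw [Multiset.map_map] at this
    simpa [Function.comp_def] using this.symm
  rw [rootMoment, h2, Complex.ofReal_re]

theorem rootPowerSum_im (p : ℝ[X]) (n : ℕ) :
    ((p.aroots ℂ).map (fun z => z ^ n)).sum.im = 0 := by
  have hc : (p.map (algebraMap ℝ ℂ)).map (starRingEnd ℂ) = p.map (algebraMap ℝ ℂ) := by
    rw [Polynomial.map_map]
    congr 1
    ext x
    simp
  have hr : (p.aroots ℂ).map (starRingEnd ℂ) = p.aroots ℂ := by
    have h := (IsAlgClosed.splits (p.map (algebraMap ℝ ℂ))).roots_map (starRingEnd ℂ)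
    rw [hc] at h
    exact h.symm
  rw [← Complex.conj_eq_iff_im, map_multiset_sum, Multiset.map_map]
  conv_rhs => rw [← hr, Multiset.map_map]
  simp

/-- `(p_d)` has infinitesimal distribution `(μ, μ')`: `μ` is a probability measure with finite
moments, `μ'` a linear functional on `ℝ[x]`, and for all `n ≥ 0`, as `d → ∞`,
`m_n(p_d) → m_n(μ)` and `d (m_n(p_d) - m_n(μ)) → μ'(xⁿ)`. (For `n = 0` this gives `μ'(1) = 0`.) -/
structure HasInfinitesimalDistribution (p : ℕ → ℝ[X]) (μ : Measure ℝ) (μ' : ℝ[X] →ₗ[ℝ] ℝ) :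
    Prop where
  isProb : IsProbWithMoments μ
  limit : ∀ n, Tendsto (fun d => rootMoment d (p d) n) atTop (𝓝 (moments μ n))
  infinitesimal : ∀ n,
    Tendsto (fun d : ℕ => (d : ℝ) * (rootMoment d (p d) n - moments μ n)) atTop (𝓝 (μ' (X ^ n)))

/-- `(p_d)` has the numbers `rhat n` as cumulant fluctuations with respect to the distribution with
moment sequence `m`: `κ_n(p_d) = r_n + rhat_n / d + o(1/d)` as `d → ∞`, for every `n ≥ 1`. -/
def HasCumulantFluctuations (p : ℕ → ℝ[X]) (m rhat : ℕ → ℝ) : Prop :=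
  ∀ n, 1 ≤ n →
    (fun d : ℕ => finiteCumulant d (p d) n - (freeCumulant m n + rhat n / (d : ℝ)))
      =o[atTop] (fun d : ℕ => 1 / (d : ℝ))

/-- The formula for the cumulant fluctuations of the product, from the free cumulants `u`, `v` and
the cumulant fluctuations `u'`, `v'` of the factors. -/
noncomputable def mulFluctuation (u u' v v' : ℕ → ℝ) (n : ℕ) : ℝ :=
  (∑ π ∈ NC n,
    (derivOver u u' π * prodOver v (kreweras π) + prodOver u π * derivOver v v' (kreweras π)))
    - annularSum u v n

/-- The formula for the infinitesimal moments in terms of the free cumulants `u` and the cumulant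
fluctuations `u'`:
`∑_{π ∈ NC(n)} ∑_{V ∈ π} u'_{|V|} u_{π∖V} - (n/2) ∑_{t+s=n} ∑_{σ ∈ S_NC(t,s)} u_σ / (ts)`. -/
noncomputable def infinitesimalMoment (u u' : ℕ → ℝ) (n : ℕ) : ℝ :=
  (∑ π ∈ NC n, derivOver u u' π) - annularSum u (fun _ => 1) n

end FiniteFree

/-! The exponential generating series of the normalised coefficients of `p` has a logarithm whose
coefficients are the finite free cumulants, up to the factor `(-d)^(n-1) / (n-1)!`. Since `(n-1)!`
counts the `n`-cycles, the exponential formula turns this into an expansion over permutations: the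
`n`-th coefficient is the sum over `σ ∈ S_n` of `(-1/d)^(n - #σ) κ_σ(p)`, where `#` counts cycles
(`permSum_seqCumulant`). As `⊠_d` multiplies coefficients, those of the product are sums over pairs
`(σ, τ)`, and the logarithm keeps exactly the pairs that generate a transitive group
(`isExpSeq_pairSum`). The result is the exact identity `seqCumulant_mul`: `κ_n(p ⊠_d q) = 1/(n-1)! ∑
(-1/d)^(n+1-#σ-#τ) κ_σ(p) κ_τ(q)`, over transitive pairs.

The inequality `#σ + #τ + #(στ) ≤ n + 2` for transitive pairs (`numCycles_add_le_of_transitive`)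
bounds the exponent below by `0`. For exponent `0` the product `στ` is one of the `(n-1)!` long
cycles, and its factorisations are counted by non-crossing partitions and their Kreweras complements
(`sum_isGeodesic`, `sum_genus_zero_disc`). For exponent `1`, parity forces `στ` to have two cycles;
its factorisations are the annular non-crossing permutations, and the sizes of the conjugacy classes
produce the weight `n/(2ts)` (`sum_genus_zero_annulus`). All other pairs are `O(1/d²)`. Expanding
the cumulants of the factors to first order gives `hasExpansion_seqCumulant_mul`.

Moments are a special case. The sequence `laguerreSeq` has all cumulants equal to `1`, and by
Newton's identities the moments of `p` are the cumulants of the product of its coefficients with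
this sequence (`rootMoment_eq_seqCumulant`). The product formula with `v = 1` and `v' = 0` is thus
the formula for infinitesimal moments. Conversely, in the same identity `κ_n(p)` appears linearly,
with a coefficient that has a nonzero limit, next to cumulants of lower order. Induction therefore
yields the cumulant fluctuations from the infinitesimal moments (`exists_hasExpansion_of_mul`). -/

namespace FiniteFree

/-! ### The exponential formula -/

/-- `∑ aₙ zⁿ/n! = exp (∑ cₙ zⁿ/n!)`, as a recursion between the coefficients. -/
def IsExpSeq (a c : ℕ → ℝ) : Prop :=
  ∀ n, a (n + 1) = ∑ k ∈ Finset.range (n + 1), (n.choose k : ℝ) * c (k + 1) * a (n - k)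

/-- The top term of the recursion is `c (n + 1) * a 0`, so `a 0 = 1` makes the system triangular in
`c`. The value `c 0` never enters. -/
theorem IsExpSeq.log_unique {a c c' : ℕ → ℝ} (h0 : a 0 = 1) (h : IsExpSeq a c)
    (h' : IsExpSeq a c') : ∀ n, 1 ≤ n → c n = c' n := by
  intro n
  induction n using Nat.strong_induction_on with
  | _ n ih =>
    intro hn
    obtain ⟨n, rfl⟩ : ∃ m, n = m + 1 := ⟨n - 1, by omega⟩
    have e := (h n).symm.trans (h' n)
    rw [Finset.sum_range_succ, Finset.sum_range_succ] at e
    rw [Finset.sum_congr rfl (g := fun k => (n.choose k : ℝ) * c' (k + 1) * a (n - k))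
      (fun k hk => by rw [ih (k + 1) (by simpa using hk) (by omega)])] at e
    simpa [h0] using e

theorem IsExpSeq.exp_unique {a a' c : ℕ → ℝ} (h0 : a 0 = a' 0) (h : IsExpSeq a c)
    (h' : IsExpSeq a' c) : ∀ n, a n = a' n := by
  intro n
  induction n using Nat.strong_induction_on with
  | _ n ih =>
    obtain _ | n := n
    · exact h0
    rw [h n, h' n]
    exact Finset.sum_congr rfl fun k hk => by rw [ih (n - k) (by omega)]

theorem IsExpSeq.congr_log {a c c' : ℕ → ℝ} (h : IsExpSeq a c) (hc : ∀ n, 1 ≤ n → c n = c' n) :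
    IsExpSeq a c' := fun n => by
  rw [h n]
  exact Finset.sum_congr rfl fun k _ => by rw [hc (k + 1) (by omega)]

/-- The coefficients of the logarithm of an exponential generating series. -/
noncomputable def logSeq (a : ℕ → ℝ) : ℕ → ℝ
  | 0 => 0
  | n + 1 => a (n + 1) - ∑ k : Fin n, (n.choose k : ℝ) * logSeq a (k + 1) * a (n - k)

theorem isExpSeq_logSeq {a : ℕ → ℝ} (h0 : a 0 = 1) : IsExpSeq a (logSeq a) := by
  intro n
  rw [Finset.sum_range_succ, logSeq, ← Fin.sum_univ_eq_sum_range
    (fun k => (n.choose k : ℝ) * logSeq a (k + 1) * a (n - k)) n]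
  simp [h0]

/-- Erasing `x` leaves an arbitrary subset of an `n`-element set. Sums over the component containing
a marked point thereby take the form of the recursion in `IsExpSeq`. -/
theorem sum_powerset_filter_mem {α : Type*} [DecidableEq α] (S : Finset α) (x : α) (hx : x ∈ S)
    {n : ℕ} (hn : S.card = n + 1) (g : ℕ → ℝ) :
    ∑ T ∈ S.powerset.filter (x ∈ ·), g T.card
      = ∑ k ∈ Finset.range (n + 1), (n.choose k : ℝ) * g (k + 1) := by
  have hc : (S.erase x).card = n := by rw [Finset.card_erase_of_mem hx]; omega
  have := Finset.sum_powerset_apply_card (fun k => g (k + 1)) (x := S.erase x)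
  rw [hc] at this
  simp only [nsmul_eq_mul] at this
  rw [← this]
  refine Finset.sum_nbij' (fun T => T.erase x) (fun T => insert x T) ?_ ?_ ?_ ?_ ?_
  · intro T hT
    simp only [Finset.mem_filter, Finset.mem_powerset] at hT ⊢
    exact Finset.erase_subset_erase _ hT.1
  · intro T hT
    simp only [Finset.mem_filter, Finset.mem_powerset] at hT ⊢
    exact ⟨Finset.insert_subset hx (hT.trans (Finset.erase_subset _ _)),
      Finset.mem_insert_self _ _⟩
  · intro T hT
    simp only [Finset.mem_filter] at hT
    exact Finset.insert_erase hT.2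
  · intro T hT
    simp only [Finset.mem_powerset] at hT
    exact Finset.erase_insert fun h => by simpa using hT h
  · intro T hT
    simp only [Finset.mem_filter] at hT
    rw [Finset.card_erase_add_one hT.2]

/-- Sum over the partitions `π` of `S` of `h |π| ∏_{V ∈ π} a |V|`. -/
noncomputable def partitionSum {α : Type*} [DecidableEq α] (h a : ℕ → ℝ) (S : Finset α) : ℝ :=
  ∑ π : Finpartition S, h π.parts.card * ∏ V ∈ π.parts, a V.card

/-- A partition of `S \ U` together with the block `U` is a partition of `S` with a marked block.
The mark avoids the block of `x`, so a partition with `m` blocks arises `m - 1` times, each time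
from one with `m - 1` blocks. -/
theorem sum_mul_partitionSum_sdiff {α : Type*} [DecidableEq α] (h a : ℕ → ℝ) (S : Finset α)
    (x : α) (hx : x ∈ S) :
    ∑ U ∈ S.powerset.filter (fun U => U ≠ ∅ ∧ x ∉ U), a U.card * partitionSum h a (S \ U)
      = partitionSum (fun m => h (m - 1) * ((m - 1 : ℕ) : ℝ)) a S := by
  have hR : partitionSum (fun m => h (m - 1) * ((m - 1 : ℕ) : ℝ)) a S
      = ∑ π : Finpartition S, ∑ U ∈ π.parts.erase (π.part x),
          h (π.parts.card - 1) * ∏ V ∈ π.parts, a V.card := by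
    refine Finset.sum_congr rfl fun π _ => ?_
    rw [Finset.sum_const, Finset.card_erase_of_mem (π.part_mem.2 hx), nsmul_eq_mul]
    ring
  rw [hR]
  simp only [partitionSum, Finset.mul_sum]
  rw [Finset.sum_sigma', Finset.sum_sigma']
  have key : ∀ U : Finset α, U ⊆ S → U ≠ ∅ → ∀ ρ : Finpartition (S \ U), U ∉ ρ.parts := by
    intro U hU hne ρ hmem
    obtain ⟨y, hy⟩ := Finset.nonempty_iff_ne_empty.2 hne
    have := ρ.subset hmem hy
    simp [hy] at this
  refine Finset.sum_bij
    (fun (q : Σ U : Finset α, Finpartition (S \ U)) hq =>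
      (⟨q.2.extend (c := S) (b := q.1)
        (by simp only [Finset.mem_sigma, Finset.mem_filter] at hq; exact hq.1.2.1)
        Finset.sdiff_disjoint
        (by simp only [Finset.mem_sigma, Finset.mem_filter, Finset.mem_powerset] at hq
            exact Finset.sdiff_union_of_subset hq.1.1), q.1⟩ :
        Σ _ : Finpartition S, Finset α)) ?_ ?_ ?_ ?_
  · rintro ⟨U, ρ⟩ hq
    simp only [Finset.mem_sigma, Finset.mem_filter, Finset.mem_powerset, Finset.mem_univ,
      and_true] at hq
    simp only [Finset.mem_sigma, Finset.mem_univ, true_and, Finset.mem_erase]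
    refine ⟨fun e => hq.2.2 ?_, by simp⟩
    rw [e]
    exact Finpartition.mem_part _ hx
  · rintro ⟨U, ρ⟩ hq ⟨U', ρ'⟩ hq' e
    simp only [Finset.mem_sigma, Finset.mem_filter, Finset.mem_powerset, Finset.mem_univ,
      and_true] at hq hq'
    simp only [Sigma.mk.injEq, heq_eq_eq] at e
    obtain ⟨e1, rfl⟩ := e
    have e2 := congrArg Finpartition.parts e1
    simp only [Finpartition.extend_parts] at e2
    have e3 : ρ = ρ' := by
      ext1
      rw [← Finset.erase_insert (key U hq.1 hq.2.1 ρ), e2,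
        Finset.erase_insert (key U hq.1 hq.2.1 ρ')]
    rw [e3]
  · rintro ⟨π, U⟩ hq
    simp only [Finset.mem_sigma, Finset.mem_univ, true_and, Finset.mem_erase] at hq
    have hparts : (π.avoid U).parts = π.parts.erase U := by
      ext W
      rw [Finpartition.mem_avoid, Finset.mem_erase]
      constructor
      · rintro ⟨D, hD, hle, rfl⟩
        have hne : D ≠ U := fun e => hle e.le
        rw [show D \ U = D from sdiff_eq_left.2 (π.disjoint hD hq.2 hne)]
        exact ⟨hne, hD⟩
      · rintro ⟨hne, hW⟩
        refine ⟨W, hW, fun hle => ?_, sdiff_eq_left.2 (π.disjoint hW hq.2 hne)⟩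
        obtain ⟨y, hy⟩ := π.nonempty_of_mem_parts hW
        exact hne (π.eq_of_mem_parts hW hq.2 hy (hle hy))
    refine ⟨⟨U, π.avoid U⟩, ?_, ?_⟩
    · simp only [Finset.mem_sigma, Finset.mem_filter, Finset.mem_powerset, Finset.mem_univ,
        and_true]
      refine ⟨π.subset hq.2, π.ne_empty hq.2, fun hxU => hq.1 ?_⟩
      exact (π.part_eq_of_mem hq.2 hxU).symm
    · simp only [Sigma.mk.injEq, heq_eq_eq, and_true]
      ext1
      rw [Finpartition.extend_parts, hparts, Finset.insert_erase hq.2]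
  · rintro ⟨U, ρ⟩ hq
    simp only [Finset.mem_sigma, Finset.mem_filter, Finset.mem_powerset, Finset.mem_univ,
      and_true] at hq
    have hk := key U hq.1 hq.2.1 ρ
    simp only [Finpartition.extend_parts, Finset.card_insert_of_notMem hk,
      Finset.prod_insert hk, Nat.add_sub_cancel]
    ring

/-- The weight `(-1)^{m-1} (m-1)!` of the Möbius function of the partition lattice. -/
noncomputable def moebiusWeight (m : ℕ) : ℝ := (-1) ^ (m - 1) * ((m - 1).factorial : ℝ)

theorem partitionSum_add {α : Type*} [DecidableEq α] (h h' a : ℕ → ℝ) (S : Finset α) :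
    partitionSum h a S + partitionSum h' a S = partitionSum (fun m => h m + h' m) a S := by
  simp only [partitionSum, ← Finset.sum_add_distrib, add_mul]

theorem partitionSum_one_block {α : Type*} [DecidableEq α] (a : ℕ → ℝ) (S : Finset α)
    (hS : S.Nonempty) : partitionSum (fun m => if m = 1 then 1 else 0) a S = a S.card := by
  rw [partitionSum, Finset.sum_eq_single (Finpartition.indiscrete hS.ne_empty)]
  · simp
  · intro π _ hπ
    rw [if_neg, zero_mul]
    intro h1
    obtain ⟨V, hV⟩ := Finset.card_eq_one.1 h1
    apply hπ
    ext1
    have := π.biUnion_parts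
    rw [hV, Finset.singleton_biUnion] at this
    rw [hV]
    exact congrArg _ this
  · simp

/-- The terms with `T ≠ S` carry the weight `(m - 1) w(m - 1)` on partitions with `m` blocks, `w`
being `moebiusWeight`. Since `w(m) = -(m - 1) w(m - 1)` for `m ≥ 2`, they cancel the term `T = S`
except on the one-block partition. -/
theorem sum_partitionSum_moebiusWeight {α : Type*} [DecidableEq α] {a : ℕ → ℝ} (h0 : a 0 = 1)
    (S : Finset α) (x : α) (hx : x ∈ S) :
    ∑ T ∈ S.powerset.filter (x ∈ ·), partitionSum moebiusWeight a T * a (S \ T).card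
      = a S.card := by
  have hmem : S ∈ S.powerset.filter (x ∈ ·) := by simp [hx]
  rw [← Finset.add_sum_erase _ _ hmem]
  have h1 : ∑ T ∈ (S.powerset.filter (x ∈ ·)).erase S,
      partitionSum moebiusWeight a T * a (S \ T).card
      = ∑ U ∈ S.powerset.filter (fun U => U ≠ ∅ ∧ x ∉ U),
        a U.card * partitionSum moebiusWeight a (S \ U) := by
    refine Finset.sum_nbij' (fun T => S \ T) (fun T => S \ T) ?_ ?_ ?_ ?_ ?_
    · intro T hT
      simp only [Finset.mem_erase, Finset.mem_filter, Finset.mem_powerset] at hT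
      simp only [Finset.mem_filter, Finset.mem_powerset, Finset.sdiff_subset, true_and,
        Finset.mem_sdiff, hT.2.2, not_true_eq_false, and_false, not_false_eq_true, and_true]
      intro h
      exact hT.1 (hT.2.1.antisymm (Finset.sdiff_eq_empty_iff_subset.1 h))
    · intro U hU
      simp only [Finset.mem_filter, Finset.mem_powerset] at hU
      simp only [Finset.mem_erase, Finset.mem_filter, Finset.mem_powerset, Finset.sdiff_subset,
        Finset.mem_sdiff, hx, hU.2.2, not_false_eq_true, and_true]
      intro h
      apply hU.2.1
      rw [← Finset.sdiff_sdiff_eq_self hU.1, h, Finset.sdiff_self]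
    · intro T hT
      simp only [Finset.mem_erase, Finset.mem_filter, Finset.mem_powerset] at hT
      exact Finset.sdiff_sdiff_eq_self hT.2.1
    · intro U hU
      simp only [Finset.mem_filter, Finset.mem_powerset] at hU
      exact Finset.sdiff_sdiff_eq_self hU.1
    · intro T hT
      simp only [Finset.mem_erase, Finset.mem_filter, Finset.mem_powerset] at hT
      rw [Finset.sdiff_sdiff_eq_self hT.2.1, mul_comm]
  rw [h1, sum_mul_partitionSum_sdiff _ _ _ x hx, Finset.sdiff_self, Finset.card_empty, h0, mul_one,
    partitionSum_add, ← partitionSum_one_block a S ⟨x, hx⟩]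
  refine Finset.sum_congr rfl fun π _ => ?_
  congr 1
  have hpos : 0 < π.parts.card := Finset.card_pos.2 (π.parts_nonempty (Finset.ne_empty_of_mem hx))
  obtain ⟨m, hm⟩ : ∃ m, π.parts.card = m + 1 := ⟨_, (Nat.succ_pred_eq_of_pos hpos).symm⟩
  rw [hm]
  obtain _ | m := m
  · simp [moebiusWeight]
  · simp [moebiusWeight, Nat.factorial_succ, pow_succ]
    ring

/-- Möbius inversion on the partition lattice: both sides satisfy the same recursion over the
subsets containing a fixed point, so they agree by induction on `S`. -/
theorem partitionSum_eq_of_isExpSeq {α : Type*} [DecidableEq α] {a c : ℕ → ℝ} (h0 : a 0 = 1)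
    (h : IsExpSeq a c) (S : Finset α) (hS : S.Nonempty) :
    partitionSum moebiusWeight a S = c S.card := by
  induction S using Finset.strongInduction with
  | H S ih =>
    obtain ⟨x, hx⟩ := hS
    have hmem : S ∈ S.powerset.filter (x ∈ ·) := by simp [hx]
    obtain ⟨n, hn⟩ : ∃ n, S.card = n + 1 :=
      ⟨S.card - 1, by have := Finset.card_pos.2 ⟨x, hx⟩; omega⟩
    have e1 := sum_partitionSum_moebiusWeight h0 S x hx
    have e2 := sum_powerset_filter_mem S x hx hn (fun k => c k * a (n + 1 - k))
    simp only [Nat.add_sub_add_right, ← mul_assoc] at e2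
    rw [← h n, ← hn, ← e1, ← Finset.add_sum_erase _ _ hmem, ← Finset.add_sum_erase _ _ hmem] at e2
    have e3 : ∑ T ∈ (S.powerset.filter (x ∈ ·)).erase S, c T.card * a (S.card - T.card)
        = ∑ T ∈ (S.powerset.filter (x ∈ ·)).erase S,
          partitionSum moebiusWeight a T * a (S \ T).card := by
      refine Finset.sum_congr rfl fun T hT => ?_
      simp only [Finset.mem_erase, Finset.mem_filter, Finset.mem_powerset] at hT
      rw [ih T (hT.2.1.ssubset_of_ne hT.1) ⟨x, hT.2.2⟩, Finset.card_sdiff_of_subset hT.2.1]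
    rw [e3, add_left_inj] at e2
    simpa [h0] using e2.symm

/-! ### Cycles of permutations -/

section Cycles

variable {α : Type*} [Fintype α] [DecidableEq α]

/-- The product of `u |c|` over the cycles `c` of `σ`, fixed points included. -/
def cycleProd (u : ℕ → ℝ) (σ : Equiv.Perm α) : ℝ := (σ.partition.parts.map u).prod

/-- The number of cycles of `σ`, fixed points included. -/
def numCycles (σ : Equiv.Perm α) : ℕ := σ.partition.parts.card

theorem parts_partition_extendDomain {β : Type*} [Fintype β] [DecidableEq β] {p : β → Prop}
    [DecidablePred p] (f : α ≃ Subtype p) (g : Equiv.Perm α) :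
    (g.extendDomain f).partition.parts
      = g.partition.parts + Multiset.replicate (Fintype.card β - Fintype.card α) 1 := by
  have h1 := g.sum_cycleType_le
  have h2 : Fintype.card α ≤ Fintype.card β :=
    Fintype.card_le_of_injective (fun a => (f a : β)) (Subtype.val_injective.comp f.injective)
  rw [Equiv.Perm.parts_partition, Equiv.Perm.parts_partition, ← Equiv.Perm.sum_cycleType,
    ← Equiv.Perm.sum_cycleType, Equiv.Perm.cycleType_extendDomain, add_assoc,
    ← Multiset.replicate_add]
  congr 2
  omega

theorem parts_partition_permCongr {β : Type*} [Fintype β] [DecidableEq β] (e : α ≃ β)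
    (g : Equiv.Perm α) : (e.permCongr g).partition.parts = g.partition.parts := by
  have h : e.permCongr g
      = g.extendDomain (p := fun _ : β => True) (e.trans (Equiv.subtypeUnivEquiv fun _ => trivial).symm) := by
    ext b
    rw [Equiv.Perm.extendDomain_apply_subtype _ _ (b := b) trivial]
    simp [Equiv.subtypeUnivEquiv]
  rw [h, parts_partition_extendDomain, Nat.sub_eq_zero_of_le (Fintype.card_congr e).ge]
  simp

/-- Each factor counts the support of the other among its fixed points; together they have `|α|`
fixed points more than the product. -/
theorem parts_partition_mul {σ τ : Equiv.Perm α} (h : σ.Disjoint τ) :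
    (σ * τ).partition.parts + Multiset.replicate (Fintype.card α) 1
      = σ.partition.parts + τ.partition.parts := by
  have h1 := (σ * τ).sum_cycleType_le
  rw [h.cycleType_mul, Multiset.sum_add] at h1
  simp only [Equiv.Perm.parts_partition, ← Equiv.Perm.sum_cycleType]
  rw [h.cycleType_mul, Multiset.sum_add, add_assoc, ← Multiset.replicate_add, add_add_add_comm,
    ← Multiset.replicate_add]
  congr 2
  omega

theorem parts_partition_subtypeCongr {p : α → Prop} [DecidablePred p]
    [Fintype {a // p a}] [Fintype {a // ¬ p a}] (σ : Equiv.Perm {a // p a}) (τ : Equiv.Perm {a // ¬ p a}) :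
    (Equiv.Perm.subtypeCongr σ τ).partition.parts = σ.partition.parts + τ.partition.parts := by
  have h : Equiv.Perm.subtypeCongr σ τ
      = σ.extendDomain (Equiv.refl {a // p a}) * τ.extendDomain (Equiv.refl {a // ¬ p a}) := by
    ext a
    by_cases ha : p a
    · rw [Equiv.Perm.subtypeCongr.left_apply _ _ ha, Equiv.Perm.mul_apply,
        Equiv.Perm.extendDomain_apply_not_subtype τ (Equiv.refl {a // ¬ p a}) (by simpa using ha),
        Equiv.Perm.extendDomain_apply_subtype _ _ ha]
      rfl
    · rw [Equiv.Perm.subtypeCongr.right_apply _ _ ha, Equiv.Perm.mul_apply,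
        Equiv.Perm.extendDomain_apply_subtype τ (Equiv.refl {a // ¬ p a}) ha]
      exact (Equiv.Perm.extendDomain_apply_not_subtype σ (Equiv.refl {a // p a})
        (τ ⟨a, ha⟩).2).symm
  have hd : (σ.extendDomain (Equiv.refl {a // p a})).Disjoint
      (τ.extendDomain (Equiv.refl {a // ¬ p a})) := by
    intro a
    by_cases ha : p a
    · exact Or.inr (Equiv.Perm.extendDomain_apply_not_subtype τ (Equiv.refl {a // ¬ p a})
        (by simpa using ha))
    · exact Or.inl (Equiv.Perm.extendDomain_apply_not_subtype σ _ ha)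
  have h1 := parts_partition_mul hd
  rw [← h, parts_partition_extendDomain, parts_partition_extendDomain, add_add_add_comm,
    ← Multiset.replicate_add] at h1
  have hc := Fintype.card_subtype_compl p
  have hle := Fintype.card_subtype_le p
  rw [show Fintype.card α - Fintype.card {a // p a} + (Fintype.card α - Fintype.card {a // ¬ p a})
    = Fintype.card α by omega] at h1
  exact add_right_cancel h1

theorem cycleProd_subtypeCongr (u : ℕ → ℝ) {p : α → Prop} [DecidablePred p]
    [Fintype {a // p a}] [Fintype {a // ¬ p a}] (σ : Equiv.Perm {a // p a}) (τ : Equiv.Perm {a // ¬ p a}) :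
    cycleProd u (Equiv.Perm.subtypeCongr σ τ) = cycleProd u σ * cycleProd u τ := by
  simp [cycleProd, parts_partition_subtypeCongr]

theorem mem_parts_ofSetoid (r : Setoid α) [DecidableRel r.r] (V : Finset α) :
    V ∈ (Finpartition.ofSetoid r).parts ↔ ∃ x, ∀ y, y ∈ V ↔ r x y := by
  simp only [Finpartition.ofSetoid, Finpartition.ofSetSetoid, Finset.mem_image,
    Finset.mem_univ, true_and]
  constructor
  · rintro ⟨x, rfl⟩
    exact ⟨x, fun y => by simp⟩
  · rintro ⟨x, hx⟩
    exact ⟨x, by ext y; simp [hx]⟩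

/-- The family `P` is given only by its membership condition, so that the result applies both to the
orbit partition and to the single block of a transitive cycle. -/
theorem map_card_orbits (σ : Equiv.Perm α) (P : Finset (Finset α))
    (hP : ∀ V, V ∈ P ↔ ∃ x, ∀ y, y ∈ V ↔ σ.SameCycle x y) :
    P.val.map Finset.card = σ.partition.parts := by
  have hparts : P = σ.cycleFactorsFinset.image Equiv.Perm.support
        ∪ (σ.supportᶜ).image (fun x => ({x} : Finset α)) := by
    have hfix : ∀ x y, x ∉ σ.support → (σ.SameCycle x y ↔ y = x) := by
      intro x y hx
      rw [Equiv.Perm.notMem_support] at hx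
      constructor
      · rintro ⟨i, rfl⟩
        exact Equiv.Perm.zpow_apply_eq_self_of_apply_eq_self hx i
      · rintro rfl; exact Equiv.Perm.SameCycle.refl _ _
    ext V
    rw [hP]
    simp only [Finset.mem_union, Finset.mem_image, Finset.mem_compl]
    constructor
    · rintro ⟨x, hx⟩
      by_cases hs : x ∈ σ.support
      · refine Or.inl ⟨σ.cycleOf x, Equiv.Perm.cycleOf_mem_cycleFactorsFinset_iff.2 hs, ?_⟩
        ext y
        rw [hx, Equiv.Perm.mem_support_cycleOf_iff' (Equiv.Perm.mem_support.1 hs)]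
      · refine Or.inr ⟨x, hs, ?_⟩
        ext y
        rw [hx, hfix x y hs, Finset.mem_singleton]
    · rintro (⟨c, hc, rfl⟩ | ⟨x, hx, rfl⟩)
      · obtain ⟨x, hx⟩ := (Equiv.Perm.mem_cycleFactorsFinset_iff.1 hc).1.nonempty_support
        refine ⟨x, fun y => ?_⟩
        have hs := Equiv.Perm.mem_cycleFactorsFinset_support_le hc hx
        rw [Equiv.Perm.cycle_is_cycleOf hx hc,
          Equiv.Perm.mem_support_cycleOf_iff' (Equiv.Perm.mem_support.1 hs)]
      · exact ⟨x, fun y => by rw [hfix x y hx, Finset.mem_singleton]⟩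
  have hdisj : Disjoint (σ.cycleFactorsFinset.image Equiv.Perm.support)
      ((σ.supportᶜ).image (fun x => ({x} : Finset α))) := by
    rw [Finset.disjoint_left]
    intro V hV hV'
    simp only [Finset.mem_image] at hV hV'
    obtain ⟨c, hc, rfl⟩ := hV
    obtain ⟨x, -, hx⟩ := hV'
    have := (Equiv.Perm.mem_cycleFactorsFinset_iff.1 hc).1.two_le_card_support
    rw [← hx] at this
    simp at this
  rw [hparts, ← Finset.disjUnion_eq_union _ _ hdisj, Finset.disjUnion_val, Multiset.map_add,
    Equiv.Perm.parts_partition, Equiv.Perm.cycleType_def]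
  congr 1
  · rw [Finset.image_val_of_injOn, Multiset.map_map]
    · intro c hc c' hc' h
      obtain ⟨x, hx⟩ := (Equiv.Perm.mem_cycleFactorsFinset_iff.1 hc).1.nonempty_support
      rw [Equiv.Perm.cycle_is_cycleOf hx hc]
      rw [h] at hx
      rw [← Equiv.Perm.cycle_is_cycleOf hx hc']
  · rw [Finset.image_val_of_injOn (Finset.singleton_injective.injOn), Multiset.map_map]
    simp only [Function.comp_def, Finset.card_singleton, Multiset.map_const', ← Finset.card_def,
      Finset.card_compl]

/-- The blocks of the orbit partition have the sizes recorded in `σ.partition`. -/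
theorem map_card_parts_ofSetoid (σ : Equiv.Perm α)
    [DecidableRel (Equiv.Perm.SameCycle.setoid σ).r] :
    (Finpartition.ofSetoid (Equiv.Perm.SameCycle.setoid σ)).parts.val.map Finset.card
      = σ.partition.parts :=
  map_card_orbits σ _ fun V => mem_parts_ofSetoid (Equiv.Perm.SameCycle.setoid σ) V

/-- The number of classes of an equivalence relation. -/
noncomputable def numClasses (r : Setoid α) : ℕ := Nat.card (Quotient r)

theorem card_parts_ofSetoid (r : Setoid α) [DecidableRel r.r] :
    (Finpartition.ofSetoid r).parts.card = numClasses r := by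
  classical
  rw [numClasses, Nat.card_eq_fintype_card, ← Finset.card_univ]
  symm
  have hcls : ∀ x y, (Finset.univ.filter fun z => r x z) = (Finset.univ.filter fun z => r y z)
      ↔ r x y := by
    intro x y
    constructor
    · intro h
      have : y ∈ Finset.univ.filter fun z => r x z := by rw [h]; simp
      simpa using this
    · intro h
      ext z
      simp only [Finset.mem_filter, Finset.mem_univ, true_and]
      exact ⟨fun h' => r.trans (r.symm h) h', fun h' => r.trans h h'⟩
  refine Finset.card_bij (fun q _ => Quotient.lift (s := r)
    (fun x => (Finset.univ.filter fun z => r x z)) (fun x y h => (hcls x y).2 h) q) ?_ ?_ ?_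
  · intro q _
    induction q using Quotient.inductionOn with
    | h x =>
      simp only [Finpartition.ofSetoid, Finpartition.ofSetSetoid, Finset.mem_image,
        Finset.mem_univ, true_and, Quotient.lift_mk]
      refine ⟨x, ?_⟩
      ext; simp
  · intro q _ q' _ h
    induction q using Quotient.inductionOn with
    | h x =>
    induction q' using Quotient.inductionOn with
    | h y => exact Quotient.sound ((hcls x y).1 h)
  · intro V hV
    simp only [Finpartition.ofSetoid, Finpartition.ofSetSetoid, Finset.mem_image,
        Finset.mem_univ, true_and] at hV
    obtain ⟨x, rfl⟩ := hV
    exact ⟨Quotient.mk r x, Finset.mem_univ _, by simp only [Quotient.lift_mk]⟩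

theorem numCycles_eq_numClasses (σ : Equiv.Perm α) :
    numCycles σ = numClasses (Equiv.Perm.SameCycle.setoid σ) := by
  classical
  rw [← card_parts_ofSetoid, numCycles, ← map_card_parts_ofSetoid, Multiset.card_map]
  rfl

end Cycles

theorem cycleProd_eq_prodOver (u : ℕ → ℝ) {n : ℕ} (σ : Equiv.Perm (Fin n)) :
    cycleProd u σ = prodOver u (cyclePartition σ) := by
  classical
  rw [cycleProd, ← map_card_parts_ofSetoid, Multiset.map_map, prodOver, cyclePartition]
  rfl

theorem numCycles_eq_card_cyclePartition {n : ℕ} (σ : Equiv.Perm (Fin n)) :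
    numCycles σ = (cyclePartition σ).parts.card := by
  classical
  rw [numCycles, ← map_card_parts_ofSetoid, Multiset.card_map, cyclePartition]
  rfl

/-! ### Pairs of permutations and their joint orbits -/

/-- Positive powers follow by transitivity and negative ones by symmetry. Comparisons of orbit
relations thus reduce to one step of each generator. -/
theorem sameCycle_setoid_le_iff {α : Type*} {σ : Equiv.Perm α} {r : Setoid α} :
    Equiv.Perm.SameCycle.setoid σ ≤ r ↔ ∀ x, r x (σ x) := by
  constructor
  · intro h x
    exact h (show σ.SameCycle x (σ x) from ⟨1, by simp⟩)
  · intro h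
    have hn : ∀ (n : ℕ) x, r x ((σ ^ n) x) := by
      intro n
      induction n with
      | zero => intro x; exact r.refl x
      | succ n ih => intro x; rw [pow_succ', Equiv.Perm.mul_apply]; exact r.trans (ih x) (h _)
    rintro x y ⟨i, rfl⟩
    obtain ⟨n, rfl | rfl⟩ := i.eq_nat_or_neg
    · simpa using hn n x
    · have := hn n ((σ ^ (-(n : ℤ))) x)
      rw [← Equiv.Perm.mul_apply, ← zpow_natCast, ← zpow_add, add_neg_cancel, zpow_zero] at this
      exact r.symm this

/-- The orbit relation of the group generated by two permutations. -/
def joint {α : Type*} (q : Equiv.Perm α × Equiv.Perm α) : Setoid α :=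
  Equiv.Perm.SameCycle.setoid q.1 ⊔ Equiv.Perm.SameCycle.setoid q.2

theorem joint_le_iff {α : Type*} {q : Equiv.Perm α × Equiv.Perm α} {r : Setoid α} :
    joint q ≤ r ↔ (∀ x, r x (q.1 x)) ∧ ∀ x, r x (q.2 x) := by
  rw [joint, sup_le_iff, sameCycle_setoid_le_iff, sameCycle_setoid_le_iff]

theorem joint_left {α : Type*} (q : Equiv.Perm α × Equiv.Perm α) (x : α) : joint q x (q.1 x) :=
  (joint_le_iff.1 le_rfl).1 x

theorem joint_right {α : Type*} (q : Equiv.Perm α × Equiv.Perm α) (x : α) : joint q x (q.2 x) :=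
  (joint_le_iff.1 le_rfl).2 x

section Pairs

variable {α : Type*} [Fintype α] [DecidableEq α]

open Classical in
/-- Sum over the pairs of permutations generating a transitive group. -/
noncomputable def transSum (α : Type*) [Fintype α] [DecidableEq α] (e e' : ℕ → ℝ) : ℝ :=
  ∑ q ∈ Finset.univ.filter (fun q : Equiv.Perm α × Equiv.Perm α => joint q = ⊤),
    cycleProd e q.1 * cycleProd e' q.2

/-- Sum over all pairs of permutations. -/
noncomputable def pairSum (α : Type*) [Fintype α] [DecidableEq α] (e e' : ℕ → ℝ) : ℝ :=
  ∑ q : Equiv.Perm α × Equiv.Perm α, cycleProd e q.1 * cycleProd e' q.2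

theorem cycleProd_permCongr {β : Type*} [Fintype β] [DecidableEq β] (u : ℕ → ℝ) (f : α ≃ β)
    (σ : Equiv.Perm α) : cycleProd u (f.permCongr σ) = cycleProd u σ := by
  rw [cycleProd, parts_partition_permCongr, cycleProd]

theorem joint_permCongr {α β : Type*} (f : α ≃ β)
    (q : Equiv.Perm α × Equiv.Perm α) (h : joint q = ⊤) :
    joint (f.permCongr q.1, f.permCongr q.2) = ⊤ := by
  have h1 : joint q ≤ (joint (f.permCongr q.1, f.permCongr q.2)).comap f := by
    rw [joint_le_iff]
    refine ⟨fun x => ?_, fun x => ?_⟩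
    · have := joint_left (f.permCongr q.1, f.permCongr q.2) (f x)
      rw [Setoid.comap_rel]
      simpa only [Equiv.permCongr_apply, Equiv.symm_apply_apply] using this
    · have := joint_right (f.permCongr q.1, f.permCongr q.2) (f x)
      rw [Setoid.comap_rel]
      simpa only [Equiv.permCongr_apply, Equiv.symm_apply_apply] using this
  rw [h] at h1
  rw [eq_top_iff]
  intro x y _
  have : (joint (f.permCongr q.1, f.permCongr q.2)).comap f (f.symm x) (f.symm y) :=
    h1 trivial
  simpa only [Setoid.comap_rel, Equiv.apply_symm_apply] using this

theorem pairSum_congr {β : Type*} [Fintype β] [DecidableEq β] (e e' : ℕ → ℝ) (f : α ≃ β) :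
    pairSum α e e' = pairSum β e e' := by
  refine Fintype.sum_equiv (f.permCongr.prodCongr f.permCongr) _ _ fun q => ?_
  simp [cycleProd_permCongr]

theorem transSum_congr {β : Type*} [Fintype β] [DecidableEq β] (e e' : ℕ → ℝ) (f : α ≃ β) :
    transSum α e e' = transSum β e e' := by
  classical
  refine Finset.sum_nbij' (fun q => (f.permCongr q.1, f.permCongr q.2))
    (fun q => (f.symm.permCongr q.1, f.symm.permCongr q.2)) ?_ ?_ ?_ ?_ ?_
  · intro q hq
    simp only [Finset.mem_filter, Finset.mem_univ, true_and] at hq ⊢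
    exact joint_permCongr f q hq
  · intro q hq
    simp only [Finset.mem_filter, Finset.mem_univ, true_and] at hq ⊢
    exact joint_permCongr f.symm q hq
  · intro q _
    ext <;> simp
  · intro q _
    ext <;> simp
  · intro q _
    simp [cycleProd_permCongr]

/-- Group the pairs by the joint orbit `T` of `x`. Such a pair is a transitive pair on `T` glued to
an arbitrary pair on the complement. -/
theorem pairSum_eq_sum_orbit (e e' : ℕ → ℝ) (x : α) :
    pairSum α e e' = ∑ T ∈ (Finset.univ : Finset α).powerset.filter (x ∈ ·),
      transSum {a // a ∈ T} e e' * pairSum {a // a ∉ T} e e' := by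
  classical
  rw [pairSum, ← Finset.sum_fiberwise_of_maps_to
    (g := fun q => Finset.univ.filter fun y => joint q x y)
    (t := (Finset.univ : Finset α).powerset.filter (x ∈ ·))]
  swap
  · intro q _
    simp
  refine Finset.sum_congr rfl fun T hT => ?_
  simp only [Finset.mem_filter, Finset.mem_powerset, Finset.subset_univ, true_and] at hT
  rw [transSum, pairSum, Finset.sum_mul_sum, ← Finset.sum_product']
  symm
  refine Finset.sum_bij (fun z _ => (Equiv.Perm.subtypeCongr z.1.1 z.2.1,
    Equiv.Perm.subtypeCongr z.1.2 z.2.2)) ?_ ?_ ?_ ?_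
  · rintro ⟨⟨σ, τ⟩, σ', τ'⟩ hz
    simp only [Finset.mem_product, Finset.mem_filter, Finset.mem_univ, true_and, and_true] at hz ⊢
    set q := (Equiv.Perm.subtypeCongr σ σ', Equiv.Perm.subtypeCongr τ τ') with hq
    have h1 : joint (σ, τ) ≤ (joint q).comap Subtype.val := by
      rw [joint_le_iff]
      refine ⟨fun a => ?_, fun a => ?_⟩
      · have := joint_left q a
        rwa [hq, Equiv.Perm.subtypeCongr.left_apply_subtype, ← hq] at this
      · have := joint_right q a
        rwa [hq, Equiv.Perm.subtypeCongr.left_apply_subtype, ← hq] at this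
    -- Glued permutations preserve `T`, so the joint orbit of `x` cannot leave it.
    have h2 : joint q ≤ Setoid.ker (fun a => a ∈ T) := by
      have hs : ∀ (s : Equiv.Perm {a // a ∈ T}) (s' : Equiv.Perm {a // a ∉ T}) (a : α),
          (a ∈ T) = (Equiv.Perm.subtypeCongr s s' a ∈ T) := by
        intro s s' a
        by_cases ha : a ∈ T
        · rw [Equiv.Perm.subtypeCongr.left_apply _ _ ha]
          simp [ha]
        · rw [Equiv.Perm.subtypeCongr.right_apply _ _ ha]
          simp [ha, (s' ⟨a, ha⟩).2]
      rw [joint_le_iff]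
      exact ⟨fun a => hs _ _ a, fun a => hs _ _ a⟩
    ext y
    simp only [Finset.mem_filter, Finset.mem_univ, true_and]
    constructor
    · intro h
      have h' : (x ∈ T) = (y ∈ T) := h2 h
      rwa [← h']
    · intro hy
      rw [hz] at h1
      exact h1 (x := ⟨x, hT⟩) (y := ⟨y, hy⟩) trivial
  · rintro ⟨⟨σ, τ⟩, σ', τ'⟩ hz ⟨⟨σ₁, τ₁⟩, σ₁', τ₁'⟩ hz' h
    simp only [Prod.mk.injEq] at h
    have hinj := Equiv.Perm.subtypeCongrHom_injective (fun a => a ∈ T)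
    have i1 := @hinj (σ, σ') (σ₁, σ₁') h.1
    have i2 := @hinj (τ, τ') (τ₁, τ₁') h.2
    simp only [Prod.mk.injEq] at i1 i2 ⊢
    exact ⟨⟨i1.1, i2.1⟩, i1.2, i2.2⟩
  · rintro ⟨σ, τ⟩ hq
    simp only [Finset.mem_filter, Finset.mem_univ, true_and] at hq
    have hmem : ∀ y, y ∈ T ↔ joint (σ, τ) x y := fun y => by rw [← hq]; simp
    have hσ : ∀ a, σ a ∈ T ↔ a ∈ T := fun a => by
      rw [hmem, hmem]
      exact ⟨fun h => (joint _).trans h ((joint _).symm (joint_left (σ, τ) a)),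
        fun h => (joint _).trans h (joint_left (σ, τ) a)⟩
    have hτ : ∀ a, τ a ∈ T ↔ a ∈ T := fun a => by
      rw [hmem, hmem]
      exact ⟨fun h => (joint _).trans h ((joint _).symm (joint_right (σ, τ) a)),
        fun h => (joint _).trans h (joint_right (σ, τ) a)⟩
    have hcongr : ∀ (ρ : Equiv.Perm α) (h : ∀ a, ρ a ∈ T ↔ a ∈ T),
        Equiv.Perm.subtypeCongr (p := fun a => a ∈ T) (ρ.subtypePerm h)
          (ρ.subtypePerm (p := fun a => a ∉ T) fun a => not_congr (h a)) = ρ := by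
      intro ρ h
      ext a
      by_cases ha : a ∈ T
      · rw [Equiv.Perm.subtypeCongr.left_apply _ _ ha]; rfl
      · rw [Equiv.Perm.subtypeCongr.right_apply _ _ ha]; rfl
    refine ⟨⟨(σ.subtypePerm hσ, τ.subtypePerm hτ),
      (σ.subtypePerm (p := fun a => a ∉ T) fun a => not_congr (hσ a),
        τ.subtypePerm (p := fun a => a ∉ T) fun a => not_congr (hτ a))⟩, ?_, ?_⟩
    · simp only [Finset.mem_product, Finset.mem_filter, Finset.mem_univ, true_and, and_true]
      set r := joint (σ.subtypePerm hσ, τ.subtypePerm hτ) with hr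
      -- This relation is `r` on `T` and lumps the complement into one class. It contains the steps
      -- of `σ` and `τ`, hence their joint relation, so being joined in `α` implies being joined by
      -- the restrictions.
      let s : Setoid α :=
        { r := fun a b => (a ∈ T ↔ b ∈ T) ∧ ∀ ha hb, r ⟨a, ha⟩ ⟨b, hb⟩
          iseqv := ⟨fun a => ⟨Iff.rfl, fun _ _ => r.refl _⟩,
            fun h => ⟨h.1.symm, fun ha hb => r.symm (h.2 hb ha)⟩,
            fun h h' => ⟨h.1.trans h'.1, fun ha hb =>
              r.trans (h.2 ha (h.1.1 ha)) (h'.2 (h.1.1 ha) hb)⟩⟩ }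
      have hs : joint (σ, τ) ≤ s := by
        rw [joint_le_iff]
        exact ⟨fun a => ⟨(hσ a).symm, fun ha hb => joint_left (σ.subtypePerm hσ, τ.subtypePerm hτ) ⟨a, ha⟩⟩,
          fun a => ⟨(hτ a).symm, fun ha hb => joint_right (σ.subtypePerm hσ, τ.subtypePerm hτ) ⟨a, ha⟩⟩⟩
      rw [eq_top_iff]
      rintro ⟨a, ha⟩ ⟨b, hb⟩ -
      have hab : joint (σ, τ) a b :=
        (joint _).trans ((joint _).symm ((hmem a).1 ha)) ((hmem b).1 hb)
      exact (hs hab).2 ha hb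
    · simp only [hcongr]
  · rintro ⟨⟨σ, τ⟩, σ', τ'⟩ hz
    simp only [cycleProd_subtypeCongr]
    ring

end Pairs

/-- Transitive pairs are the connected structures among all pairs: the recursion is the
decomposition by the joint orbit of the point `0`. -/
theorem isExpSeq_pairSum (e e' : ℕ → ℝ) :
    IsExpSeq (fun n => pairSum (Fin n) e e') (fun n => transSum (Fin n) e e') := by
  intro n
  have h := sum_powerset_filter_mem (Finset.univ : Finset (Fin (n + 1))) 0 (Finset.mem_univ _)
    (n := n) (by simp)
    (fun k => transSum (Fin k) e e' * pairSum (Fin (n + 1 - k)) e e')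
  have h' : ∑ k ∈ Finset.range (n + 1), (n.choose k : ℝ) * transSum (Fin (k + 1)) e e'
      * pairSum (Fin (n - k)) e e'
      = ∑ T ∈ (Finset.univ : Finset (Fin (n + 1))).powerset.filter (0 ∈ ·),
        transSum (Fin T.card) e e' * pairSum (Fin (n + 1 - T.card)) e e' := by
    rw [h]
    exact Finset.sum_congr rfl fun k _ => by rw [Nat.add_sub_add_right, mul_assoc]
  simp only
  rw [h', pairSum_eq_sum_orbit e e' (0 : Fin (n + 1))]
  refine Finset.sum_congr rfl fun T _ => ?_
  rw [transSum_congr e e' (Fintype.equivFinOfCardEq (α := {a // a ∈ T}) (n := T.card) (by simp)),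
    pairSum_congr e e' (Fintype.equivFinOfCardEq (α := {a // a ∉ T}) (n := n + 1 - T.card) ?_)]
  rw [Fintype.card_subtype_compl, Fintype.card_coe, Fintype.card_fin]

/-- `∑_{σ ∈ S_n} e_σ`. -/
noncomputable def permSum (e : ℕ → ℝ) (n : ℕ) : ℝ := ∑ σ : Equiv.Perm (Fin n), cycleProd e σ

theorem permSum_zero (e : ℕ → ℝ) : permSum e 0 = 1 := by
  simp [permSum, cycleProd, Equiv.Perm.parts_partition]

theorem pairSum_eq_mul (e e' : ℕ → ℝ) (n : ℕ) :
    pairSum (Fin n) e e' = permSum e n * permSum e' n := by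
  rw [pairSum, permSum, permSum, Finset.sum_mul_sum, ← Finset.sum_product']
  rfl

theorem cycleProd_one {α : Type*} [Fintype α] [DecidableEq α] {u : ℕ → ℝ} (h1 : u 1 = 1) :
    cycleProd u (1 : Equiv.Perm α) = 1 := by
  simp [cycleProd, Equiv.Perm.parts_partition, h1]

theorem cycleProd_eq_zero {α : Type*} [Fintype α] [DecidableEq α] {u : ℕ → ℝ}
    (hu : ∀ k, 2 ≤ k → u k = 0) {σ : Equiv.Perm α} (hσ : σ ≠ 1) : cycleProd u σ = 0 := by
  obtain ⟨k, hk⟩ := Multiset.card_pos_iff_exists_mem.1 (Equiv.Perm.card_cycleType_pos.2 hσ)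
  refine Multiset.prod_eq_zero (Multiset.mem_map.2 ⟨k, ?_, hu k
    (Equiv.Perm.two_le_of_mem_cycleType hk)⟩)
  rw [Equiv.Perm.parts_partition]
  exact Multiset.mem_add.2 (Or.inl hk)

theorem sameCycle_one {α : Type*} : Equiv.Perm.SameCycle.setoid (1 : Equiv.Perm α) = ⊥ := by
  rw [eq_bot_iff, sameCycle_setoid_le_iff]
  intro x
  rfl

theorem parts_eq_singleton_of_top {α : Type*} [Fintype α] [DecidableEq α] [Nonempty α]
    {σ : Equiv.Perm α} (h : Equiv.Perm.SameCycle.setoid σ = ⊤) :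
    σ.partition.parts = {Fintype.card α} := by
  classical
  rw [← map_card_orbits σ {Finset.univ}]
  · simp
  · intro V
    have h' : ∀ x y, σ.SameCycle x y := fun x y => by
      change Equiv.Perm.SameCycle.setoid σ x y
      rw [h]; trivial
    simp only [Finset.mem_singleton, h', iff_true, exists_const]
    exact Finset.eq_univ_iff_forall

open Classical in
-- Take the second weight to be `1` on fixed points and `0` on longer cycles. Only pairs `(σ, 1)`
-- survive, and such a pair is transitive exactly when `σ` is a single cycle.
theorem isExpSeq_permSum_aux (e : ℕ → ℝ) :
    IsExpSeq (permSum e) (fun n => e n * ((Finset.univ.filter fun σ : Equiv.Perm (Fin n) =>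
      Equiv.Perm.SameCycle.setoid σ = ⊤).card : ℝ)) := by
  set δ : ℕ → ℝ := fun k => if k = 1 then 1 else 0 with hδ
  have h0 : ∀ n (τ : Equiv.Perm (Fin n)), cycleProd δ τ = if τ = 1 then 1 else 0 := by
    intro n τ
    split_ifs with h
    · rw [h, cycleProd_one (by simp [hδ])]
    · exact cycleProd_eq_zero (fun k hk => by simp [hδ]; omega) h
  have h := isExpSeq_pairSum e δ
  have h1 : (fun n => pairSum (Fin n) e δ) = permSum e := by
    ext n
    rw [pairSum_eq_mul]
    simp [permSum, h0]
  rw [h1] at h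
  refine h.congr_log fun n hn => ?_
  have : Nonempty (Fin n) := ⟨⟨0, hn⟩⟩
  rw [transSum, mul_comm, ← nsmul_eq_mul, ← Finset.sum_const]
  symm
  refine Finset.sum_of_injOn (fun σ => (σ, 1)) (fun σ _ σ' _ h => (Prod.mk.inj h).1) ?_ ?_ ?_
  · intro σ hσ
    simp only [Finset.coe_filter, Finset.mem_univ, true_and, Set.mem_ofPred_eq] at hσ ⊢
    rw [joint, hσ, top_sup_eq]
  · rintro ⟨σ, τ⟩ hq hn
    simp only [Finset.mem_filter, Finset.mem_univ, true_and, Finset.coe_filter,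
      Set.mem_image, Set.mem_ofPred_eq, not_exists, not_and] at hq hn
    rw [h0, if_neg, mul_zero]
    rintro rfl
    refine hn σ ?_ rfl
    rwa [joint, sameCycle_one, sup_bot_eq] at hq
  · intro σ hσ
    simp only [Finset.mem_filter, Finset.mem_univ, true_and] at hσ
    rw [h0, if_pos rfl, mul_one, cycleProd, parts_eq_singleton_of_top hσ]
    simp

open Classical in
/-- The number of `n`-cycles. -/
theorem card_sameCycle_eq_top {n : ℕ} (hn : 1 ≤ n) :
    ((Finset.univ.filter fun σ : Equiv.Perm (Fin n) =>
      Equiv.Perm.SameCycle.setoid σ = ⊤).card : ℝ) = (n - 1).factorial := by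
  -- With all weights equal to `1` the permutation sum is `n!`. The sequence `(n - 1)!` also solves
  -- the recursion, and logarithms are unique.
  have h := isExpSeq_permSum_aux (fun _ => 1)
  simp only [one_mul] at h
  have h1 : permSum (fun _ => 1) = fun n => (n.factorial : ℝ) := by
    ext n
    simp [permSum, cycleProd, Fintype.card_perm]
  have h2 : IsExpSeq (permSum (fun _ => 1)) (fun n => ((n - 1).factorial : ℝ)) := by
    intro m
    rw [h1]
    simp only [Nat.add_sub_cancel]
    rw [Finset.sum_congr rfl (g := fun _ => (m.factorial : ℝ))]
    · simp [Nat.factorial_succ]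
    · intro k hk
      exact_mod_cast Nat.choose_mul_factorial_mul_factorial
        (Nat.lt_succ_iff.1 (Finset.mem_range.1 hk))
  exact h.log_unique (permSum_zero _) h2 n hn

theorem isExpSeq_permSum (e : ℕ → ℝ) :
    IsExpSeq (permSum e) (fun n => e n * (n - 1).factorial) :=
  (isExpSeq_permSum_aux e).congr_log fun n hn => by rw [card_sameCycle_eq_top hn]

/-! ### The genus inequality -/

theorem swap_setoid_le_iff {α : Type*} [DecidableEq α] {a b : α} {r : Setoid α} :
    Equiv.Perm.SameCycle.setoid (Equiv.swap a b) ≤ r ↔ r a b := by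
  rw [sameCycle_setoid_le_iff]
  constructor
  · intro h
    simpa using h a
  · intro h x
    rcases eq_or_ne x a with rfl | hxa
    · simpa using h
    · rcases eq_or_ne x b with rfl | hxb
      · simpa using r.symm h
      · rw [Equiv.swap_apply_of_ne_of_ne hxa hxb]

/-- Together with the transposition, `σ` and `σ * swap a b` generate the same group. -/
theorem setoid_mul_swap_sup {α : Type*} [DecidableEq α] (σ : Equiv.Perm α) (a b : α) :
    Equiv.Perm.SameCycle.setoid (σ * Equiv.swap a b)
        ⊔ Equiv.Perm.SameCycle.setoid (Equiv.swap a b)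
      = Equiv.Perm.SameCycle.setoid σ ⊔ Equiv.Perm.SameCycle.setoid (Equiv.swap a b) := by
  have key : ∀ σ : Equiv.Perm α, Equiv.Perm.SameCycle.setoid (σ * Equiv.swap a b)
        ⊔ Equiv.Perm.SameCycle.setoid (Equiv.swap a b)
      ≤ Equiv.Perm.SameCycle.setoid σ ⊔ Equiv.Perm.SameCycle.setoid (Equiv.swap a b) := by
    intro σ
    refine sup_le ?_ le_sup_right
    rw [sameCycle_setoid_le_iff]
    intro x
    exact Setoid.trans' _ (joint_right (σ, Equiv.swap a b) x)
      (joint_left (σ, Equiv.swap a b) (Equiv.swap a b x))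
  refine (key σ).antisymm ?_
  have := key (σ * Equiv.swap a b)
  rwa [mul_assoc, Equiv.swap_mul_self, mul_one] at this

theorem numClasses_top {α : Type*} [Nonempty α] : numClasses (⊤ : Setoid α) = 1 := by
  rw [numClasses, Nat.card_eq_one_iff_unique]
  refine ⟨⟨fun p q => ?_⟩, ⟨Quotient.mk _ (Classical.arbitrary α)⟩⟩
  induction p using Quotient.inductionOn
  induction q using Quotient.inductionOn
  exact Quotient.sound trivial

section Genus

variable {α : Type*} [Fintype α] [DecidableEq α]

theorem numClasses_sup_swap (r : Setoid α) {a b : α} (h : ¬ r a b) :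
    numClasses (r ⊔ Equiv.Perm.SameCycle.setoid (Equiv.swap a b)) + 1 = numClasses r := by
  classical
  have hab : (Quotient.mk r a) ≠ Quotient.mk r b := fun e => h (Quotient.exact e)
  -- The map renames the class of `b` as the class of `a`: its kernel is the join, and its range
  -- misses only the class of `b`.
  set f : α → Quotient r := fun x => if r b x then Quotient.mk r a else Quotient.mk r x with hf
  have hker : r ⊔ Equiv.Perm.SameCycle.setoid (Equiv.swap a b) = Setoid.ker f := by
    apply le_antisymm
    · rw [sup_le_iff, swap_setoid_le_iff]
      constructor
      · intro x y hxy
        have e : r b x ↔ r b y :=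
          ⟨fun h' => r.trans h' hxy, fun h' => r.trans h' (r.symm hxy)⟩
        simp only [Setoid.ker_def, hf, e]
        rw [Quotient.sound hxy]
      · simp [Setoid.ker_def, hf]
    · intro x y hxy
      set s := r ⊔ Equiv.Perm.SameCycle.setoid (Equiv.swap a b) with hs
      have hr : ∀ {u v}, r u v → s u v := fun h' => (le_sup_left : r ≤ s) h'
      have hab : s a b := swap_setoid_le_iff.1 le_sup_right
      rw [Setoid.ker_def] at hxy
      simp only [hf] at hxy
      split_ifs at hxy with hx hy hy
      · exact hr (r.trans (r.symm hx) hy)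
      · exact s.trans (hr (r.symm hx)) (s.trans (s.symm hab) (hr (Quotient.exact hxy)))
      · exact s.trans (hr (Quotient.exact hxy)) (s.trans hab (hr hy))
      · exact hr (Quotient.exact hxy)
  rw [hker, numClasses, numClasses, Nat.card_congr (Setoid.quotientKerEquivRange f)]
  have hrange : Set.range f = (Finset.univ.erase (Quotient.mk r b) : Finset (Quotient r)) := by
    ext q
    simp only [Set.mem_range, Finset.coe_erase, Finset.coe_univ, Set.mem_sdiff, Set.mem_univ,
      Set.mem_singleton_iff, true_and]
    constructor
    · rintro ⟨x, rfl⟩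
      simp only [hf]
      split_ifs with hx
      · exact hab
      · exact fun e => hx (r.symm (Quotient.exact e))
    · induction q using Quotient.inductionOn with
      | h x =>
        intro hx
        exact ⟨x, if_neg fun h' => hx (Quotient.sound (r.symm h'))⟩
  rw [hrange, Nat.card_coe_set_eq, Set.ncard_coe_finset,
    Nat.card_eq_fintype_card, Finset.card_erase_of_mem (Finset.mem_univ _), Finset.card_univ]
  have : 0 < Fintype.card (Quotient r) := Fintype.card_pos_iff.2 ⟨Quotient.mk r b⟩
  omega

theorem numCycles_le (σ : Equiv.Perm α) : numCycles σ ≤ Fintype.card α := by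
  classical
  rw [numCycles_eq_numClasses, numClasses, Nat.card_eq_fintype_card]
  exact Fintype.card_le_of_surjective _ Quotient.mk_surjective

theorem numCycles_pos [Nonempty α] (σ : Equiv.Perm α) : 0 < numCycles σ := by
  classical
  rw [numCycles_eq_numClasses, numClasses, Nat.card_eq_fintype_card]
  exact Fintype.card_pos_iff.2 ⟨Quotient.mk _ (Classical.arbitrary α)⟩

theorem sign_eq_numCycles (σ : Equiv.Perm α) :
    Equiv.Perm.sign σ = (-1) ^ (Fintype.card α + numCycles σ) := by
  have h := σ.sum_cycleType_le
  rw [Equiv.Perm.sign_of_cycleType, numCycles, Equiv.Perm.parts_partition, Multiset.card_add,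
    Multiset.card_replicate, ← Equiv.Perm.sum_cycleType]
  obtain ⟨k, hk⟩ := Nat.exists_eq_add_of_le h
  rw [hk, Nat.add_sub_cancel_left, show σ.cycleType.sum + k + (σ.cycleType.card + k)
    = σ.cycleType.sum + σ.cycleType.card + 2 * k by ring, pow_add _ _ (2 * k), pow_mul]
  simp

/-- This is multiplicativity of the sign. It rules out a one-cycle product in the annular case. -/
theorem numCycles_parity (σ τ : Equiv.Perm α) :
    (numCycles σ + numCycles τ + numCycles (σ * τ)) % 2 = Fintype.card α % 2 := by
  have h := Equiv.Perm.sign_mul σ τ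
  rw [sign_eq_numCycles, sign_eq_numCycles, sign_eq_numCycles, ← pow_add] at h
  have h' : ((-1 : ℤˣ) ^ (Fintype.card α + numCycles (σ * τ)
      + (Fintype.card α + numCycles σ + (Fintype.card α + numCycles τ)))) = 1 := by
    rw [pow_add, h, ← pow_add, ← two_mul, pow_mul]
    simp
  rw [neg_one_pow_eq_ite] at h'
  have : Even (Fintype.card α + numCycles (σ * τ)
      + (Fintype.card α + numCycles σ + (Fintype.card α + numCycles τ))) := by
    by_contra hc
    rw [if_neg hc] at h'
    exact absurd h' (by decide)
  rw [Nat.even_iff] at this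
  omega

/-- Once `a` and `b` are identified the two permutations have the same number `N` of classes, so
each has `N` or `N + 1` cycles. The sign forbids equal counts, so the count for `σ` decides the
other. -/
theorem numCycles_mul_swap (σ : Equiv.Perm α) {a b : α} (hab : a ≠ b) :
    (σ.SameCycle a b → numCycles (σ * Equiv.swap a b) = numCycles σ + 1) ∧
      (¬ σ.SameCycle a b → numCycles (σ * Equiv.swap a b) + 1 = numCycles σ) := by
  set s := Equiv.Perm.SameCycle.setoid (Equiv.swap a b) with hs
  have hpar : numCycles (σ * Equiv.swap a b) ≠ numCycles σ := by
    intro e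
    have h := Equiv.Perm.sign_mul σ (Equiv.swap a b)
    rw [sign_eq_numCycles, e, ← sign_eq_numCycles, Equiv.Perm.sign_swap hab] at h
    exact absurd h (by
      rcases Int.units_eq_one_or (Equiv.Perm.sign σ) with h' | h' <;> rw [h'] <;> decide)
  have hcase : ∀ ρ : Equiv.Perm α,
      (ρ.SameCycle a b → numClasses (Equiv.Perm.SameCycle.setoid ρ ⊔ s) = numCycles ρ) ∧
      (¬ ρ.SameCycle a b → numClasses (Equiv.Perm.SameCycle.setoid ρ ⊔ s) + 1 = numCycles ρ) := by
    intro ρ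
    constructor
    · intro h
      rw [sup_eq_left.2 (swap_setoid_le_iff.2 h), numCycles_eq_numClasses]
    · intro h
      rw [hs, numClasses_sup_swap _ h, numCycles_eq_numClasses]
  have h1 := hcase σ
  have h2 := hcase (σ * Equiv.swap a b)
  rw [hs] at h1
  rw [hs, setoid_mul_swap_sup] at h2
  refine ⟨fun c1 => ?_, fun c1 => ?_⟩ <;> by_cases c2 : (σ * Equiv.swap a b).SameCycle a b
  · exact absurd ((h2.1 c2).symm.trans (h1.1 c1)) hpar
  · have := h1.1 c1; have := h2.2 c2; omega
  · have := h1.2 c1; have := h2.1 c2; omega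
  · exact absurd ((h2.2 c2).symm.trans (h1.2 c1)) hpar

theorem numCycles_one : numCycles (1 : Equiv.Perm α) = Fintype.card α := by
  simp [numCycles, Equiv.Perm.parts_partition]

/-- The Riemann–Hurwitz inequality for a pair of permutations. -/
theorem numCycles_add_le (σ τ : Equiv.Perm α) :
    numCycles σ + numCycles τ + numCycles (σ * τ)
      ≤ Fintype.card α + 2 * numClasses (joint (σ, τ)) := by
  -- Induction on the number of transpositions in `τ`: the transposition of `a` and `τ a` is
  -- stripped off, which splits a cycle of `τ`.
  induction hk : Fintype.card α - numCycles τ using Nat.strong_induction_on generalizing τ with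
  | _ k ih =>
    by_cases hτ : τ = 1
    · subst hτ
      rw [joint, sameCycle_one, sup_bot_eq, ← numCycles_eq_numClasses, numCycles_one, mul_one]
      show _ ≤ Fintype.card α + 2 * numCycles σ
      omega
    · obtain ⟨a, ha⟩ : ∃ a, τ a ≠ a := by
        by_contra! h
        exact hτ (Equiv.ext h)
      set b := τ a
      have hab : a ≠ b := ha.symm
      have hsc : τ.SameCycle a b := ⟨1, by simp [b]⟩
      set τ' := τ * Equiv.swap a b with hτ'
      have hτ2 : τ = τ' * Equiv.swap a b := by
        rw [hτ', mul_assoc, Equiv.swap_mul_self, mul_one]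
      have e1 : numCycles τ' = numCycles τ + 1 := (numCycles_mul_swap τ hab).1 hsc
      have hle := numCycles_le τ'
      have h := ih (Fintype.card α - numCycles τ') (by omega) τ' rfl
      have hJ : joint (σ, τ) = joint (σ, τ') ⊔ Equiv.Perm.SameCycle.setoid (Equiv.swap a b) := by
        have e := setoid_mul_swap_sup τ a b
        rw [sup_eq_left (a := Equiv.Perm.SameCycle.setoid τ) |>.2 (swap_setoid_le_iff.2 hsc)] at e
        rw [joint, joint, sup_assoc, e]
      have hprod : σ * τ = σ * τ' * Equiv.swap a b := by rw [mul_assoc, ← hτ2]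
      have h3 := numCycles_mul_swap (σ * τ') hab
      rw [← hprod] at h3
      by_cases hj : joint (σ, τ') a b
      -- The joint orbits are unchanged. Going from `τ'` to `τ` loses one cycle, and the product
      -- gains at most one.
      · rw [hJ, sup_eq_left.2 (swap_setoid_le_iff.2 hj)]
        by_cases c : (σ * τ').SameCycle a b
        · have := h3.1 c; omega
        · have := h3.2 c; omega
      -- Two joint orbits merge, so the bound drops by `2`; so do the cycle counts, since `a` and
      -- `b` lie in different cycles of `σ * τ'` too.
      · have hJ' := numClasses_sup_swap _ hj
        rw [← hJ] at hJ'
        have c : ¬ (σ * τ').SameCycle a b := by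
          intro c
          apply hj
          have : Equiv.Perm.SameCycle.setoid (σ * τ') ≤ joint (σ, τ') := by
            rw [sameCycle_setoid_le_iff]
            intro x
            exact Setoid.trans' _ (joint_right (σ, τ') x) (joint_left (σ, τ') (τ' x))
          exact this c
        have := h3.2 c
        omega

theorem numCycles_add_le_of_transitive [Nonempty α] {σ τ : Equiv.Perm α} (h : joint (σ, τ) = ⊤) :
    numCycles σ + numCycles τ + numCycles (σ * τ) ≤ Fintype.card α + 2 := by
  have := numCycles_add_le σ τ
  rw [h, numClasses_top] at this
  exact this

end Genus

/-! ### Finite free cumulants of coefficient sequences -/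

/-- The finite free cumulants as a function of the sequence of normalised coefficients. -/
noncomputable def seqCumulant (d : ℕ) (a : ℕ → ℝ) (n : ℕ) : ℝ :=
  (-(d : ℝ)) ^ (n - 1) / ((n - 1).factorial : ℝ) *
    partitionSum moebiusWeight a (Finset.univ : Finset (Fin n))

theorem finiteCumulant_eq_seqCumulant (d : ℕ) (p : ℝ[X]) (n : ℕ) :
    finiteCumulant d p n = seqCumulant d (normCoeff d p) n := rfl

theorem seqCumulant_eq_of_isExpSeq (d : ℕ) {a c : ℕ → ℝ} (h0 : a 0 = 1) (h : IsExpSeq a c)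
    {n : ℕ} (hn : 1 ≤ n) :
    seqCumulant d a n = (-(d : ℝ)) ^ (n - 1) / ((n - 1).factorial : ℝ) * c n := by
  rw [seqCumulant, partitionSum_eq_of_isExpSeq h0 h _ ⟨⟨0, hn⟩, Finset.mem_univ _⟩]
  simp

theorem cycleProd_mul_pow {α : Type*} [Fintype α] [DecidableEq α] (u : ℕ → ℝ) (r : ℝ)
    (σ : Equiv.Perm α) :
    cycleProd (fun k => u k * r ^ (k - 1)) σ
      = cycleProd u σ * r ^ (Fintype.card α - numCycles σ) := by
  have key : ∀ m : Multiset ℕ, (∀ k ∈ m, 1 ≤ k) →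
      m.card ≤ m.sum ∧ (m.map fun k => u k * r ^ (k - 1)).prod
        = (m.map u).prod * r ^ (m.sum - m.card) := by
    intro m
    induction m using Multiset.induction with
    | empty => simp
    | cons k m ih =>
      intro h
      obtain ⟨h1, h2⟩ := ih fun j hj => h j (Multiset.mem_cons_of_mem hj)
      have hk := h k (Multiset.mem_cons_self k m)
      refine ⟨by simp; omega, ?_⟩
      rw [Multiset.map_cons, Multiset.prod_cons, h2, Multiset.map_cons, Multiset.prod_cons,
        Multiset.sum_cons, Multiset.card_cons,
        show k + m.sum - (m.card + 1) = (k - 1) + (m.sum - m.card) by omega, pow_add]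
      ring
  rw [cycleProd, (key _ fun k hk => σ.partition.parts_pos hk).2, σ.partition.parts_sum]
  rfl

/-- The logarithm of a permutation sum is `e n * (n - 1)!`, and the weight `(-1/d)^(k-1)` undoes the
normalisation `(-d)^(k-1) / (k-1)!` of the cumulants. -/
theorem permSum_seqCumulant {d : ℕ} (hd : d ≠ 0) {a : ℕ → ℝ} (h0 : a 0 = 1) :
    permSum (fun k => seqCumulant d a k * (-1 / (d : ℝ)) ^ (k - 1)) = a := by
  ext n
  have hd' : (d : ℝ) ≠ 0 := Nat.cast_ne_zero.2 hd
  refine (isExpSeq_permSum _).exp_unique (by rw [permSum_zero, h0])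
    ((isExpSeq_logSeq h0).congr_log fun k hk => ?_) n
  have hf : ((k - 1).factorial : ℝ) ≠ 0 := Nat.cast_ne_zero.2 (Nat.factorial_ne_zero _)
  have e : (-(d : ℝ)) ^ (k - 1) * (-1 / (d : ℝ)) ^ (k - 1) = 1 := by
    rw [← mul_pow]
    field_simp
    simp
  rw [seqCumulant_eq_of_isExpSeq d h0 (isExpSeq_logSeq h0) hk]
  field_simp
  linear_combination -(logSeq a k) * e

open Classical in
/-- The genus expansion of the finite free cumulants of a product. -/
theorem seqCumulant_mul {d : ℕ} (hd : d ≠ 0) {a b : ℕ → ℝ} (ha : a 0 = 1) (hb : b 0 = 1)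
    {n : ℕ} (hn : 1 ≤ n) :
    seqCumulant d (fun k => a k * b k) n = 1 / ((n - 1).factorial : ℝ) *
      ∑ q ∈ Finset.univ.filter
          (fun q : Equiv.Perm (Fin n) × Equiv.Perm (Fin n) => joint q = ⊤),
        (-1 / (d : ℝ)) ^ (n + 1 - numCycles q.1 - numCycles q.2) *
          (cycleProd (seqCumulant d a) q.1 * cycleProd (seqCumulant d b) q.2) := by
  have hd' : (d : ℝ) ≠ 0 := Nat.cast_ne_zero.2 hd
  have h := isExpSeq_pairSum (fun k => seqCumulant d a k * (-1 / (d : ℝ)) ^ (k - 1))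
    (fun k => seqCumulant d b k * (-1 / (d : ℝ)) ^ (k - 1))
  simp only [pairSum_eq_mul, permSum_seqCumulant hd ha, permSum_seqCumulant hd hb] at h
  rw [seqCumulant_eq_of_isExpSeq d (by rw [ha, hb, one_mul]) h hn, transSum, div_mul_eq_mul_div,
    div_mul_eq_mul_div, one_mul, Finset.mul_sum]
  congr 1
  refine Finset.sum_congr rfl fun q hq => ?_
  have : Nonempty (Fin n) := ⟨⟨0, hn⟩⟩
  have hg := numCycles_add_le_of_transitive (σ := q.1) (τ := q.2) (Finset.mem_filter.1 hq).2
  have hp := numCycles_pos (q.1 * q.2)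
  have h1 := numCycles_le q.1
  have h2 := numCycles_le q.2
  rw [Fintype.card_fin] at hg h1 h2
  rw [cycleProd_mul_pow, cycleProd_mul_pow, Fintype.card_fin]
  have e : (-(d : ℝ)) ^ (n - 1) * (-1 / (d : ℝ)) ^ (n - 1) = 1 := by
    rw [← mul_pow]
    field_simp
    simp
  -- The genus bound gives `#σ + #τ ≤ n + 1`, so the truncated subtraction is exact here.
  have e2 : (-1 / (d : ℝ)) ^ (n - numCycles q.1) * (-1 / (d : ℝ)) ^ (n - numCycles q.2)
      = (-1 / (d : ℝ)) ^ (n - 1) * (-1 / (d : ℝ)) ^ (n + 1 - numCycles q.1 - numCycles q.2) := by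
    rw [← pow_add, ← pow_add]
    congr 1
    omega
  rw [mul_mul_mul_comm, e2]
  linear_combination ((-1 / (d : ℝ)) ^ (n + 1 - numCycles q.1 - numCycles q.2) *
    (cycleProd (seqCumulant d a) q.1 * cycleProd (seqCumulant d b) q.2)) * e

/-! ### Non-crossing partitions as geodesic permutations -/

section Biane

variable {n : ℕ}

/-- `z` lies strictly between `x` and `y` in the cyclic order; the open arc from `x` to `x` is the
complement of `x`. -/
def Between (x z y : Fin n) : Prop := (x < z ∧ z < y) ∨ (z < y ∧ y ≤ x) ∨ (y ≤ x ∧ x < z)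

/-- The open arcs from `x` to `σ x` are `σ`-invariant. -/
def ArcInvariant (σ : Equiv.Perm (Fin n)) : Prop :=
  ∀ x z, Between x z (σ x) ↔ Between x (σ z) (σ x)

theorem not_between_left (x y : Fin n) : ¬ Between x x y := by
  simp only [Between]; omega

theorem not_between_right (x y : Fin n) : ¬ Between x y y := by
  simp only [Between]; omega

theorem finRotate_val_cases (i : Fin n) :
    ((finRotate n i : Fin n) : ℕ) = i + 1 ∨ ((i : ℕ) + 1 = n ∧ ((finRotate n i : Fin n) : ℕ) = 0) := by
  obtain _ | n := n
  · exact i.elim0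
  · rcases eq_or_ne i (Fin.last n) with rfl | h
    · right; simp
    · left; rw [coe_finRotate_of_ne_last h]

theorem ArcInvariant.between_iff {σ : Equiv.Perm (Fin n)} (h : ArcInvariant σ) {i j : Fin n}
    (hij : σ.SameCycle i j) (x : Fin n) : Between x i (σ x) ↔ Between x j (σ x) := by
  have : Equiv.Perm.SameCycle.setoid σ ≤ Setoid.ker fun z => Between x z (σ x) := by
    rw [sameCycle_setoid_le_iff]
    exact fun z => propext (h x z)
  exact iff_of_eq (this hij)

theorem arcInvariant_finRotate : ArcInvariant (finRotate n) := by
  intro x z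
  have : ∀ w, ¬ Between x w (finRotate n x) := by
    intro w
    have h := finRotate_val_cases x
    simp only [Between, Fin.lt_def, Fin.le_def]
    omega
  exact iff_of_false (this _) (this _)

/-- The step moves `σ` towards the long cycle, agreeing with it at `i`. The new arc at `i` is empty,
the one at `j` is the intersection of the old arcs at `i` and `j`, and no other arc separates `i`
from `σ j`. -/
theorem ArcInvariant.merge {σ : Equiv.Perm (Fin n)} (h : ArcInvariant σ) {i j : Fin n}
    (hij : i ≠ j) (hj : σ j = finRotate n i) : ArcInvariant (σ * Equiv.swap i j) := by
  have hg := finRotate_val_cases i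
  have hne : σ i ≠ finRotate n i := fun e => hij (σ.injective (e.trans hj.symm))
  set g := finRotate n i
  have hBj : Between i j (σ i) := by
    rw [h i j, hj]
    simp only [Between, Fin.lt_def, Fin.le_def, ne_eq, Fin.ext_iff] at *
    omega
  intro x z
  simp only [Equiv.Perm.mul_apply]
  rcases eq_or_ne x i with rfl | hxi
  · rw [Equiv.swap_apply_left, hj]
    have : ∀ w, ¬ Between x w g := by
      intro w
      simp only [Between, Fin.lt_def, Fin.le_def]
      omega
    simp [this]
  rcases eq_or_ne x j with rfl | hxj
  · rw [Equiv.swap_apply_right]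
    have key : ∀ w, Between x w (σ i) ↔ Between x w (σ x) ∧ Between i w (σ i) := by
      intro w
      rw [hj]
      simp only [Between, Fin.lt_def, Fin.le_def, ne_eq, Fin.ext_iff] at *
      omega
    rcases eq_or_ne z i with rfl | hzi
    · rw [Equiv.swap_apply_left, key, key]
      simp [not_between_left, not_between_right]
    rcases eq_or_ne z x with rfl | hzx
    · rw [Equiv.swap_apply_right]
      simp [not_between_left, not_between_right]
    rw [Equiv.swap_apply_of_ne_of_ne hzi hzx, key, key, ← h x z, ← h i z]
  · rw [Equiv.swap_apply_of_ne_of_ne hxi hxj]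
    have hσx : σ x ≠ g := fun e => hxj (σ.injective (e.trans hj.symm))
    have e1 : Between x i (σ x) ↔ Between x g (σ x) := by
      simp only [Between, Fin.lt_def, Fin.le_def, ne_eq, Fin.ext_iff] at *
      omega
    have e2 : Between x j (σ x) ↔ Between x g (σ x) := by rw [← hj]; exact h x j
    rcases eq_or_ne z i with rfl | hzi
    · rw [Equiv.swap_apply_left, hj, e1]
    rcases eq_or_ne z j with rfl | hzj
    · rw [Equiv.swap_apply_right, e2, ← e1]; exact h x i
    rw [Equiv.swap_apply_of_ne_of_ne hzi hzj]
    exact h x z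

/-- This reverses `ArcInvariant.merge`. As `i` and `j` share a cycle, no arc of `σ` separates them,
which makes the new arc at `j` invariant. The new arc at `i` is its complement joined to the old arc
at `j`. -/
theorem ArcInvariant.split {σ : Equiv.Perm (Fin n)} (h : ArcInvariant σ) {i j : Fin n}
    (hij : i ≠ j) (hsc : σ.SameCycle i j) (hi : σ i = finRotate n i) :
    ArcInvariant (σ * Equiv.swap i j) := by
  have hg := finRotate_val_cases i
  have hB := fun x => h.between_iff hsc x
  have hne : σ j ≠ finRotate n i := fun e => hij (σ.injective (hi.trans e.symm))
  set g := finRotate n i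
  have hbji : ¬ Between j i (σ j) := by rw [hB]; exact not_between_left _ _
  have harc : ∀ z, Between j z g ↔ Between j (σ (Equiv.swap i j z)) g := by
    intro z
    rcases eq_or_ne z i with rfl | hzi
    · rw [Equiv.swap_apply_left]
      simp only [Between, Fin.lt_def, Fin.le_def, ne_eq, Fin.ext_iff] at *
      omega
    rcases eq_or_ne z j with rfl | hzj
    · rw [Equiv.swap_apply_right, hi]
      simp [not_between_left, not_between_right]
    rw [Equiv.swap_apply_of_ne_of_ne hzi hzj]
    have hz := hB z
    have hσz : σ z ≠ g := fun e => hzi (σ.injective (e.trans hi.symm))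
    simp only [Between, Fin.lt_def, Fin.le_def, ne_eq, Fin.ext_iff] at *
    omega
  intro x z
  rw [Equiv.Perm.mul_apply, Equiv.Perm.mul_apply]
  have hother : ∀ y, (Between y i (σ y) ↔ Between y j (σ y)) →
      (Between y z (σ y) ↔ Between y (σ (Equiv.swap i j z)) (σ y)) := by
    intro y hy
    rcases eq_or_ne z i with rfl | hzi
    · rw [Equiv.swap_apply_left, hy]; exact h y j
    rcases eq_or_ne z j with rfl | hzj
    · rw [Equiv.swap_apply_right, ← hy]; exact h y i
    rw [Equiv.swap_apply_of_ne_of_ne hzi hzj]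
    exact h y z
  rcases eq_or_ne x i with rfl | hxi
  · rw [Equiv.swap_apply_left]
    have key : ∀ w, Between x w (σ j) ↔ ¬ Between j w g ∨ Between j w (σ j) := by
      intro w
      simp only [Between, Fin.lt_def, Fin.le_def, ne_eq, Fin.ext_iff] at *
      omega
    rw [key, key, ← harc z, hother j (hB j)]
  rcases eq_or_ne x j with rfl | hxj
  · rw [Equiv.swap_apply_right, hi]
    exact harc z
  · rw [Equiv.swap_apply_of_ne_of_ne hxi hxj]
    exact hother x (hB x)

end Biane

/-! ### Geodesic permutations, arc invariance and non-crossing partitions -/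

section BianeCount

variable {n : ℕ}

theorem sameCycle_finRotate : Equiv.Perm.SameCycle.setoid (finRotate n) = ⊤ := by
  rw [eq_top_iff]
  obtain _ | n := n
  · intro x; exact x.elim0
  have key : ∀ (k : ℕ) (hk : k < n + 1), (finRotate (n + 1)).SameCycle 0 ⟨k, hk⟩ := by
    intro k
    induction k with
    | zero => intro _; exact Equiv.Perm.SameCycle.refl _ _
    | succ k ih =>
      intro hk
      have h1 := ih (by omega)
      have h2 := finRotate_val_cases (⟨k, by omega⟩ : Fin (n + 1))
      have h3 : finRotate (n + 1) ⟨k, by omega⟩ = ⟨k + 1, hk⟩ := by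
        ext
        simp only at h2 ⊢
        omega
      rw [← h3]
      exact Equiv.Perm.sameCycle_apply_right.2 h1
  intro x y _
  exact (key x x.2).symm.trans (key y y.2)

theorem numCycles_finRotate [Nonempty (Fin n)] : numCycles (finRotate n) = 1 := by
  rw [numCycles_eq_numClasses, sameCycle_finRotate, numClasses_top]

theorem joint_of_mul_eq {α : Type*} {σ τ c : Equiv.Perm α} (h : σ * τ = c) :
    joint (σ, τ) = Equiv.Perm.SameCycle.setoid σ ⊔ Equiv.Perm.SameCycle.setoid c := by
  subst h
  apply le_antisymm
  · rw [joint_le_iff]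
    exact ⟨joint_left (σ, σ * τ), fun x => Setoid.trans' _ (joint_right (σ, σ * τ) x)
      (Setoid.symm' _ (joint_left (σ, σ * τ) (τ x)))⟩
  · refine sup_le le_sup_left ?_
    rw [sameCycle_setoid_le_iff]
    exact fun x => Setoid.trans' _ (joint_right (σ, τ) x) (joint_left (σ, τ) (τ x))

/-- `σ` lies on a geodesic from the identity to the long cycle. -/
def IsGeodesic (σ : Equiv.Perm (Fin n)) : Prop :=
  numCycles σ + numCycles (σ⁻¹ * finRotate n) = n + 1

theorem numCycles_add_le_of_finRotate [Nonempty (Fin n)] (σ : Equiv.Perm (Fin n)) :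
    numCycles σ + numCycles (σ⁻¹ * finRotate n) ≤ n + 1 := by
  have hj : joint (σ, σ⁻¹ * finRotate n) = ⊤ := by
    rw [joint_of_mul_eq (mul_inv_cancel_left σ (finRotate n)), sameCycle_finRotate, sup_top_eq]
  have := numCycles_add_le_of_transitive hj
  rw [mul_inv_cancel_left, numCycles_finRotate, Fintype.card_fin] at this
  omega

/-- The modified permutation agrees with the long cycle at `i`, so `i` is cut off from its cycle in
`σ⁻¹ * finRotate n` and becomes a fixed point. This count measures progress in the two inductions
below. -/
theorem numCycles_swap_mul (σ : Equiv.Perm (Fin n)) {i : Fin n} (hi : σ i ≠ finRotate n i) :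
    numCycles ((σ * Equiv.swap i (σ⁻¹ (finRotate n i)))⁻¹ * finRotate n)
      = numCycles (σ⁻¹ * finRotate n) + 1 := by
  set τ := σ⁻¹ * finRotate n with hτ
  have hτi : σ⁻¹ (finRotate n i) = τ i := rfl
  have hne : τ i ≠ i := fun e => hi (by rw [← hτi, Equiv.Perm.inv_eq_iff_eq] at e; exact e.symm)
  have e : (σ * Equiv.swap i (τ i))⁻¹ * finRotate n = τ * Equiv.swap (τ⁻¹ i) i := by
    rw [mul_inv_rev, Equiv.swap_inv, mul_assoc, ← hτ, Equiv.swap_mul_eq_mul_swap]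
    simp
  rw [hτi, e]
  refine (numCycles_mul_swap τ ?_).1 ?_
  · intro h
    rw [Equiv.Perm.inv_eq_iff_eq] at h
    exact hne h.symm
  · exact ⟨1, by simp⟩

theorem exists_ne_finRotate {σ : Equiv.Perm (Fin n)} (h : σ ≠ finRotate n) :
    ∃ i, σ i ≠ finRotate n i := by
  by_contra! hc
  exact h (Equiv.ext hc)

theorem isGeodesic_finRotate [Nonempty (Fin n)] : IsGeodesic (finRotate n) := by
  rw [IsGeodesic, inv_mul_cancel, numCycles_one, numCycles_finRotate, Fintype.card_fin, add_comm]

/-- Merging steps lead to the long cycle. Arc invariance puts `i` and `j` in different cycles, so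
each step trades one cycle of `σ` for one of `σ⁻¹ * finRotate n` and keeps their sum. -/
theorem ArcInvariant.isGeodesic [Nonempty (Fin n)] {σ : Equiv.Perm (Fin n)} (h : ArcInvariant σ) :
    IsGeodesic σ := by
  induction hk : n - numCycles (σ⁻¹ * finRotate n) using Nat.strong_induction_on generalizing σ with
  | _ k ih =>
    by_cases hσ : σ = finRotate n
    · rw [hσ]; exact isGeodesic_finRotate
    · obtain ⟨i, hi⟩ := exists_ne_finRotate hσ
      have hcount := numCycles_swap_mul σ hi
      have hle := numCycles_le ((σ * Equiv.swap i (σ⁻¹ (finRotate n i)))⁻¹ * finRotate n)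
      rw [Fintype.card_fin] at hle
      set j := σ⁻¹ (finRotate n i) with hj
      have hσj : σ j = finRotate n i := by simp [hj]
      have hij : i ≠ j := by rintro e; rw [← e] at hσj; exact hi hσj
      have hg := ih _ (by omega) (h.merge hij hσj) rfl
      have hsc : ¬ σ.SameCycle i j := by
        intro hsc
        have hB := (h.between_iff hsc i).not.1 (not_between_left _ _)
        rw [h i j, hσj] at hB
        have hv := finRotate_val_cases i
        apply hB
        have hij' : i ≠ finRotate n i := by
          intro e
          have hc : n = 1 := by rw [← e] at hv; omega
          subst hc
          exact hij (Subsingleton.elim _ _)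
        simp only [Between, Fin.lt_def, Fin.le_def, ne_eq, Fin.ext_iff] at *
        omega
      have h2 := (numCycles_mul_swap σ hij).2 hsc
      rw [IsGeodesic] at hg ⊢
      omega

/-- The same walk applies: if `i` and `j` shared a cycle, the next permutation would violate the
genus bound. So it is again geodesic, arc invariant by induction, and `ArcInvariant.split` leads
back to `σ`. -/
theorem IsGeodesic.arcInvariant [Nonempty (Fin n)] {σ : Equiv.Perm (Fin n)} (h : IsGeodesic σ) :
    ArcInvariant σ := by
  induction hk : n - numCycles (σ⁻¹ * finRotate n) using Nat.strong_induction_on generalizing σ with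
  | _ k ih =>
    by_cases hσ : σ = finRotate n
    · rw [hσ]; exact arcInvariant_finRotate
    · obtain ⟨i, hi⟩ := exists_ne_finRotate hσ
      have hcount := numCycles_swap_mul σ hi
      have hle := numCycles_le ((σ * Equiv.swap i (σ⁻¹ (finRotate n i)))⁻¹ * finRotate n)
      have hle2 := numCycles_add_le_of_finRotate (σ * Equiv.swap i (σ⁻¹ (finRotate n i)))
      rw [Fintype.card_fin] at hle
      set j := σ⁻¹ (finRotate n i) with hj
      have hσj : σ j = finRotate n i := by simp [hj]
      have hij : i ≠ j := by rintro e; rw [← e] at hσj; exact hi hσj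
      have hs := numCycles_mul_swap σ hij
      set σ' := σ * Equiv.swap i j with hσ'
      have hback : σ' * Equiv.swap i j = σ := by
        rw [hσ', mul_assoc, Equiv.swap_mul_self, mul_one]
      have hsc : ¬ σ.SameCycle i j := by
        intro hsc
        have := hs.1 hsc
        rw [IsGeodesic] at h
        omega
      have h2 := hs.2 hsc
      have hg : IsGeodesic σ' := by
        rw [IsGeodesic] at h ⊢
        omega
      have hs' := numCycles_mul_swap σ' hij
      rw [hback] at hs'
      have hsc' : σ'.SameCycle i j := by
        by_contra hc
        have := hs'.2 hc
        omega
      have := (ih _ (by omega) hg rfl).split hij hsc' (by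
        rw [hσ', Equiv.Perm.mul_apply, Equiv.swap_apply_left, hσj])
      rwa [hback] at this

theorem mem_cyclePartition_part {σ : Equiv.Perm (Fin n)} {x y : Fin n} :
    y ∈ (cyclePartition σ).part x ↔ σ.SameCycle x y := by
  classical
  exact Finpartition.mem_part_ofSetoid_iff_rel

theorem blockCycle_not_between {V : Finset (Fin n)} {x z : Fin n} (hx : x ∈ V) (hz : z ∈ V) :
    ¬ Between x z (blockCycle V x) := by
  have hs : (V.sort (· ≤ ·)).SortedLT := V.sortedLT_sort
  obtain ⟨k, hk, rfl⟩ := List.getElem_of_mem ((Finset.mem_sort (s := V) (· ≤ ·)).2 hx)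
  obtain ⟨m, hm, rfl⟩ := List.getElem_of_mem ((Finset.mem_sort (s := V) (· ≤ ·)).2 hz)
  rw [blockCycle, List.formPerm_apply_getElem _ (V.sort_nodup _)]
  have hlt : ∀ {a b : ℕ} (ha : a < (V.sort (· ≤ ·)).length) (hb : b < (V.sort (· ≤ ·)).length),
      (V.sort (· ≤ ·))[a] < (V.sort (· ≤ ·))[b] ↔ a < b := fun ha hb => hs.getElem_lt_getElem_iff
  have hlt' : ∀ {a b : ℕ} (ha : a < (V.sort (· ≤ ·)).length) (hb : b < (V.sort (· ≤ ·)).length),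
      (V.sort (· ≤ ·))[a] ≤ (V.sort (· ≤ ·))[b] ↔ a ≤ b := fun ha hb => by
    rw [← not_lt, hlt hb ha, not_lt]
  simp only [Between, hlt, hlt']
  rcases Nat.lt_or_ge (k + 1) (V.sort (· ≤ ·)).length with h | h
  · rw [Nat.mod_eq_of_lt h]; omega
  · rw [show k + 1 = (V.sort (· ≤ ·)).length by omega, Nat.mod_self]; omega

theorem next_unique {V : Finset (Fin n)} {x y y' : Fin n}
    (hy : y ∈ V) (hy' : y' ∈ V) (h : ∀ z ∈ V, ¬ Between x z y) (h' : ∀ z ∈ V, ¬ Between x z y') :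
    y = y' := by
  have h1 := h y' hy'
  have h2 := h' y hy
  simp only [Between] at h1 h2
  omega

theorem toPerm_mem_part (π : SetPartition n) (x : Fin n) : toPerm π x ∈ π.part x :=
  blockCycle_mem (π.mem_part (Finset.mem_univ x))

theorem toPerm_not_between (π : SetPartition n) {x z : Fin n} (hz : z ∈ π.part x) :
    ¬ Between x z (toPerm π x) :=
  blockCycle_not_between (π.mem_part (Finset.mem_univ x)) hz

theorem IsNonCrossing.arcInvariant {π : SetPartition n} (h : IsNonCrossing π) :
    ArcInvariant (toPerm π) := by
  -- A chord `x y` of one block has every other block on one side: points `z` and `w` of `W` on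
  -- different sides would form a crossing.
  have hcross : ∀ V ∈ π.parts, ∀ W ∈ π.parts, V ≠ W → ∀ x ∈ V, ∀ y ∈ V, ∀ z ∈ W, ∀ w ∈ W,
      x ≠ y → Between x z y → Between x w y := by
    intro V hV W hW hne x hx y hy z hz w hw hxy hB
    have hd : ∀ u ∈ V, ∀ v ∈ W, u ≠ v := fun u hu v hv e =>
      hne (π.eq_of_mem_parts hV hW hu (e ▸ hv))
    have n1 := hd x hx w hw
    have n2 := hd y hy w hw
    by_contra hc
    simp only [Between] at hB hc
    rcases lt_or_gt_of_ne hxy with hlt | hlt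
    · rcases lt_or_gt_of_ne n1 with h1 | h1
      · exact hne (h V hV W hW x z y w (by omega) (by omega) (by omega) hx hy hz hw)
      · exact hne (h W hW V hV w x z y (by omega) (by omega) (by omega) hw hz hx hy).symm
    · rcases lt_or_gt_of_ne (hd x hx z hz) with h1 | h1
      · exact hne (h V hV W hW y w x z (by omega) (by omega) (by omega) hy hx hw hz)
      · exact hne (h W hW V hV z y w x (by omega) (by omega) (by omega) hz hw hy hx).symm
  intro x z
  have hzz := toPerm_mem_part π z
  have hxx := toPerm_mem_part π x
  have hpz := π.mem_part (Finset.mem_univ z)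
  have hpx := π.mem_part (Finset.mem_univ x)
  by_cases hz : z ∈ π.part x
  · exact iff_of_false (toPerm_not_between π hz)
      (toPerm_not_between π (by rwa [part_eq_of_mem_part π hz] at hzz))
  · have hne : π.part x ≠ π.part z := fun e => hz (e ▸ hpz)
    have hV := π.part_mem.2 (Finset.mem_univ x)
    have hW := π.part_mem.2 (Finset.mem_univ z)
    -- At a fixed point the arc is the complement of `x`, which contains every other block.
    by_cases hx : x = toPerm π x
    · have hd : ∀ v ∈ π.part z, x ≠ v := fun v hv e =>
        hne (π.eq_of_mem_parts hV hW hpx (e ▸ hv))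
      have d1 := hd _ hpz
      have d2 := hd _ hzz
      rw [← hx]
      simp only [Between]
      omega
    · exact ⟨hcross _ hV _ hW hne _ hpx _ hxx _ hpz _ hzz hx,
        hcross _ hV _ hW hne _ hpx _ hxx _ hzz _ hpz hx⟩

/-- Invariance keeps the cycle of `x` out of the arc from `x` to `σ x`, since `x` itself is outside.
So `σ x` is the cyclic successor of `x` within its cycle. -/
theorem ArcInvariant.toPerm_cyclePartition {σ : Equiv.Perm (Fin n)} (h : ArcInvariant σ) :
    toPerm (cyclePartition σ) = σ := by
  ext1 x
  refine next_unique (V := (cyclePartition σ).part x) (x := x) (toPerm_mem_part _ x)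
    (mem_cyclePartition_part.2 ⟨1, by simp⟩) (fun z hz => toPerm_not_between _ hz) fun z hz => ?_
  rw [← h.between_iff (mem_cyclePartition_part.1 hz) x]
  exact not_between_left _ _

theorem ArcInvariant.isNonCrossing {σ : Equiv.Perm (Fin n)} (h : ArcInvariant σ) :
    IsNonCrossing (cyclePartition σ) := by
  intro V hV W hW a b c d hab hbc hcd ha hc hb hd
  by_contra hne
  have hdisj : ∀ u ∈ V, ∀ v ∈ W, u ≠ v := fun u hu v hv e =>
    hne ((cyclePartition σ).eq_of_mem_parts hV hW hu (e ▸ hv))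
  have hsc : ∀ U ∈ (cyclePartition σ).parts, ∀ u ∈ U, ∀ v, v ∈ U ↔ σ.SameCycle u v := by
    intro U hU u hu v
    rw [← mem_cyclePartition_part, (cyclePartition σ).part_eq_of_mem hU hu]
  have hne' : (V.filter (· < b)).Nonempty := ⟨a, by simp [ha, hab]⟩
  -- As `x` is the last point of `V` before `b`, its image lies after `b` and no later than `c`. The
  -- arc from `x` to `σ x` thus contains `b` but not `d`, although both lie on one cycle.
  set x := (V.filter (· < b)).max' hne' with hx
  have hxm := Finset.mem_filter.1 ((V.filter (· < b)).max'_mem hne')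
  rw [← hx] at hxm
  have hmax : ∀ y ∈ V, y < b → y ≤ x := fun y hy hyb =>
    Finset.le_max' _ _ (Finset.mem_filter.2 ⟨hy, hyb⟩)
  have hσx : σ x ∈ V := (hsc V hV x hxm.1 _).2 ⟨1, by simp⟩
  have hcB : ¬ Between x c (σ x) := by
    rw [← h.between_iff ((hsc V hV x hxm.1 c).1 hc) x]
    exact not_between_left _ _
  have hbd := h.between_iff ((hsc W hW b hb d).1 hd) x
  have hnb := hdisj _ hσx _ hb
  have hm := hmax _ hσx
  simp only [Between] at hcB hbd
  omega

theorem cyclePartition_toPerm (π : SetPartition n) : cyclePartition (toPerm π) = π := by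
  have key : ∀ x y, (toPerm π).SameCycle x y ↔ y ∈ π.part x := by
    intro x y
    constructor
    · intro h
      have : Equiv.Perm.SameCycle.setoid (toPerm π) ≤ Setoid.ker π.part := by
        rw [sameCycle_setoid_le_iff]
        intro z
        exact (part_eq_of_mem_part π (toPerm_mem_part π z)).symm
      have e : π.part x = π.part y := this h
      rw [e]
      exact π.mem_part (Finset.mem_univ y)
    · intro hy
      have hcyc := ((π.part x).sort_nodup (· ≤ ·)).isCycleOn_formPerm
      have hx := π.mem_part (Finset.mem_univ x)
      obtain ⟨i, hi⟩ := hcyc.2 (x := x) (y := y) (by simp) (by simp [hy])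
      have hpow : ∀ (k : ℕ) (z : Fin n), z ∈ π.part x →
          (toPerm π).SameCycle z ((blockCycle (π.part x) ^ k) z) ∧
            (blockCycle (π.part x) ^ k) z ∈ π.part x := by
        intro k
        induction k with
        | zero => intro z hz; exact ⟨Equiv.Perm.SameCycle.refl _ _, hz⟩
        | succ k ih =>
          intro z hz
          obtain ⟨h1, h2⟩ := ih z hz
          rw [pow_succ', Equiv.Perm.mul_apply]
          refine ⟨?_, blockCycle_mem h2⟩
          have : blockCycle (π.part x) ((blockCycle (π.part x) ^ k) z)
              = toPerm π ((blockCycle (π.part x) ^ k) z) := by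
            show _ = blockCycle (π.part _) _
            rw [part_eq_of_mem_part π h2]
          rw [this]
          exact Equiv.Perm.sameCycle_apply_right.2 h1
      have hsc : (blockCycle (π.part x)).SameCycle x y := ⟨i, hi⟩
      obtain ⟨k, -, hk⟩ := hsc.exists_pow_eq'
      rw [← hk]
      exact (hpow k x hx).1
  ext1
  ext V
  constructor
  · intro hV
    obtain ⟨x, hx⟩ := (cyclePartition (toPerm π)).nonempty_of_mem_parts hV
    have : V = π.part x := by
      rw [← (cyclePartition (toPerm π)).part_eq_of_mem hV hx]
      ext y
      rw [mem_cyclePartition_part, key]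
    rw [this]
    exact π.part_mem.2 (Finset.mem_univ x)
  · intro hV
    obtain ⟨x, hx⟩ := π.nonempty_of_mem_parts hV
    have : V = (cyclePartition (toPerm π)).part x := by
      rw [← π.part_eq_of_mem hV hx]
      ext y
      rw [mem_cyclePartition_part, key]
    rw [this]
    exact (cyclePartition (toPerm π)).part_mem.2 (Finset.mem_univ x)

open Classical in
/-- Biane's bijection between non-crossing partitions and geodesic permutations. -/
theorem sum_isGeodesic [Nonempty (Fin n)] (g : Equiv.Perm (Fin n) → ℝ) :
    ∑ σ ∈ Finset.univ.filter (fun σ : Equiv.Perm (Fin n) => IsGeodesic σ), g σ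
      = ∑ π ∈ NC n, g (toPerm π) := by
  refine Finset.sum_nbij' cyclePartition toPerm ?_ ?_ ?_ ?_ ?_
  · intro σ hσ
    exact Finset.mem_filter.2 ⟨Finset.mem_univ _,
      (Finset.mem_filter.1 hσ).2.arcInvariant.isNonCrossing⟩
  · intro π hπ
    exact Finset.mem_filter.2 ⟨Finset.mem_univ _,
      (Finset.mem_filter.1 hπ).2.arcInvariant.isGeodesic⟩
  · intro σ hσ
    exact (Finset.mem_filter.1 hσ).2.arcInvariant.toPerm_cyclePartition
  · intro π _
    exact cyclePartition_toPerm π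
  · intro σ hσ
    rw [(Finset.mem_filter.1 hσ).2.arcInvariant.toPerm_cyclePartition]

end BianeCount

/-! ### Class sums -/

theorem permCongr_inv_mul {α β : Type*} (e : α ≃ β) (σ c : Equiv.Perm α) :
    e.permCongr (σ⁻¹ * c) = (e.permCongr σ)⁻¹ * e.permCongr c := by
  ext x
  simp [Equiv.permCongr_def, Equiv.Perm.inv_def]

section ClassSums

variable {α : Type*} [Fintype α] [DecidableEq α]

open Classical in
/-- Sum over the factorisations `c = σ τ` with `σ, τ` transitive and having `k` cycles together. -/
noncomputable def factorSum (u v : ℕ → ℝ) (k : ℕ) (c : Equiv.Perm α) : ℝ :=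
  ∑ σ ∈ Finset.univ.filter (fun σ : Equiv.Perm α => joint (σ, σ⁻¹ * c) = ⊤ ∧
    numCycles σ + numCycles (σ⁻¹ * c) = k), cycleProd u σ * cycleProd v (σ⁻¹ * c)

theorem numCycles_permCongr {β : Type*} [Fintype β] [DecidableEq β] (e : α ≃ β)
    (σ : Equiv.Perm α) : numCycles (e.permCongr σ) = numCycles σ := by
  rw [numCycles, parts_partition_permCongr, numCycles]

theorem factorSum_permCongr {β : Type*} [Fintype β] [DecidableEq β] (u v : ℕ → ℝ) (k : ℕ)
    (e : α ≃ β) (c : Equiv.Perm α) :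
    factorSum u v k (e.permCongr c) = factorSum u v k c := by
  classical
  symm
  refine Finset.sum_equiv e.permCongr ?_ ?_
  · intro σ
    simp only [Finset.mem_filter, Finset.mem_univ, true_and]
    rw [← permCongr_inv_mul, numCycles_permCongr, numCycles_permCongr]
    refine and_congr_left fun _ => ⟨joint_permCongr e (σ, σ⁻¹ * c), fun h => ?_⟩
    have e1 : ∀ ρ, e.symm.permCongr (e.permCongr ρ) = ρ := e.permCongr.symm_apply_apply
    simpa only [e1] using joint_permCongr e.symm _ h
  · intro σ _
    rw [← permCongr_inv_mul, cycleProd_permCongr, cycleProd_permCongr]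

/-- Equal cycle types mean conjugate permutations, and conjugation transports factorisations. -/
theorem factorSum_congr_of_parts (u v : ℕ → ℝ) (k : ℕ) {c c' : Equiv.Perm α}
    (h : c.partition.parts = c'.partition.parts) : factorSum u v k c = factorSum u v k c' := by
  obtain ⟨ρ, hρ⟩ := isConj_iff.1 (Equiv.Perm.partition_eq_of_isConj.2 (Nat.Partition.ext h))
  rw [← hρ]
  exact (factorSum_permCongr u v k ρ c).symm

open Classical in
theorem sum_transitive_eq_sum_factorSum (u v : ℕ → ℝ) (k : ℕ) :
    ∑ q ∈ Finset.univ.filter (fun q : Equiv.Perm α × Equiv.Perm α =>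
        joint q = ⊤ ∧ numCycles q.1 + numCycles q.2 = k), cycleProd u q.1 * cycleProd v q.2
      = ∑ c : Equiv.Perm α, factorSum u v k c := by
  simp only [factorSum, Finset.sum_sigma']
  refine Finset.sum_nbij' (fun q => ⟨q.1 * q.2, q.1⟩) (fun z => (z.2, z.2⁻¹ * z.1)) ?_ ?_ ?_ ?_ ?_
  · rintro ⟨σ, τ⟩ hq
    simpa using hq
  · rintro ⟨c, σ⟩ hz
    simpa using hz
  · rintro ⟨σ, τ⟩ _
    simp
  · rintro ⟨c, σ⟩ _
    simp
  · rintro ⟨σ, τ⟩ _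
    simp

theorem factorSum_eq_zero (u v : ℕ → ℝ) (k : ℕ) [Nonempty α] {c : Equiv.Perm α}
    (h : k + numCycles c ≤ Fintype.card α + 2 → (k + numCycles c) % 2 = Fintype.card α % 2 → False) :
    factorSum u v k c = 0 := by
  classical
  rw [factorSum, Finset.sum_eq_zero]
  intro σ hσ
  obtain ⟨h1, h2⟩ := (Finset.mem_filter.1 hσ).2
  have e1 := numCycles_add_le_of_transitive h1
  have e2 := numCycles_parity σ (σ⁻¹ * c)
  rw [mul_inv_cancel_left, h2] at e1 e2
  exact (h e1 e2).elim

theorem sameCycle_eq_top_of_numCycles {c : Equiv.Perm α} (h : numCycles c = 1) :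
    Equiv.Perm.SameCycle.setoid c = ⊤ := by
  rw [numCycles_eq_numClasses, numClasses, Nat.card_eq_one_iff_unique] at h
  obtain ⟨h, -⟩ := h
  rw [eq_top_iff]
  intro x y _
  exact Quotient.exact (h.elim (Quotient.mk _ x) (Quotient.mk _ y))

end ClassSums

open Classical in
-- The genus bound leaves one cycle for the product, so it runs over the `(n - 1)!` long cycles.
-- They are conjugate and contribute equally, and the factorisations of `finRotate n` are the
-- geodesic permutations.
theorem sum_genus_zero_disc (u v : ℕ → ℝ) {n : ℕ} (hn : 1 ≤ n) :
    ∑ q ∈ Finset.univ.filter (fun q : Equiv.Perm (Fin n) × Equiv.Perm (Fin n) =>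
        joint q = ⊤ ∧ numCycles q.1 + numCycles q.2 = n + 1), cycleProd u q.1 * cycleProd v q.2
      = ((n - 1).factorial : ℝ) * ∑ π ∈ NC n, prodOver u π * prodOver v (kreweras π) := by
  have : Nonempty (Fin n) := ⟨⟨0, hn⟩⟩
  have hγ : factorSum u v (n + 1) (finRotate n)
      = ∑ π ∈ NC n, prodOver u π * prodOver v (kreweras π) := by
    have h1 := sum_isGeodesic (n := n)
      (fun σ => cycleProd u σ * cycleProd v (σ⁻¹ * finRotate n))
    simp only [cycleProd_eq_prodOver, cyclePartition_toPerm] at h1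
    rw [factorSum]
    simp only [cycleProd_eq_prodOver]
    rw [Finset.filter_congr (q := fun σ => IsGeodesic σ)]
    · exact h1
    · intro σ _
      rw [joint_of_mul_eq (mul_inv_cancel_left σ (finRotate n)), sameCycle_finRotate, sup_top_eq]
      simp [IsGeodesic]
  rw [sum_transitive_eq_sum_factorSum, ← hγ, ← card_sameCycle_eq_top hn, ← nsmul_eq_mul,
    ← Finset.sum_const]
  symm
  rw [Finset.sum_filter]
  refine Finset.sum_congr rfl fun c _ => ?_
  split_ifs with hc
  · refine factorSum_congr_of_parts u v _ ?_
    rw [parts_eq_singleton_of_top hc, parts_eq_singleton_of_top sameCycle_finRotate]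
  · symm
    refine factorSum_eq_zero u v _ fun h1 h2 => hc (sameCycle_eq_top_of_numCycles ?_)
    rw [Fintype.card_fin] at h1
    have := numCycles_pos c
    omega

/-! ### Annular factorisations and permutations with two cycles -/

theorem isPretransitive_closure_iff {α : Type*} (σ c : Equiv.Perm α) :
    MulAction.IsPretransitive (Subgroup.closure ({σ, c} : Set (Equiv.Perm α))) α
      ↔ joint (σ, c) = ⊤ := by
  constructor
  · intro h
    have key : ∀ g ∈ Subgroup.closure ({σ, c} : Set (Equiv.Perm α)), ∀ x, joint (σ, c) x (g x) := by
      intro g hg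
      induction hg using Subgroup.closure_induction with
      | mem g hg =>
        rcases hg with rfl | hg
        · exact joint_left (g, c)
        · rw [Set.mem_singleton_iff] at hg
          subst hg
          exact joint_right (σ, g)
      | one => intro x; exact Setoid.refl' _ x
      | mul g g' _ _ h1 h2 => intro x; exact Setoid.trans' _ (h2 x) (h1 _)
      | inv g _ h1 =>
        intro x
        have := Setoid.symm' _ (h1 (g⁻¹ x))
        rwa [← Equiv.Perm.mul_apply, mul_inv_cancel, Equiv.Perm.one_apply] at this
    rw [eq_top_iff]
    intro x y _
    obtain ⟨g, hg⟩ := h.exists_smul_eq x y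
    rw [← hg]
    exact key g.1 g.2 x
  · intro h
    have hle : joint (σ, c) ≤
        MulAction.orbitRel (Subgroup.closure ({σ, c} : Set (Equiv.Perm α))) α := by
      rw [joint_le_iff]
      refine ⟨fun x => Setoid.symm' _ ?_, fun x => Setoid.symm' _ ?_⟩
      · exact ⟨⟨σ, Subgroup.subset_closure (by simp)⟩, rfl⟩
      · exact ⟨⟨c, Subgroup.subset_closure (by simp)⟩, rfl⟩
    refine ⟨fun x y => ?_⟩
    have : joint (σ, c) y x := by rw [h]; trivial
    exact hle this

theorem factorSum_annularCycle (u v : ℕ → ℝ) (t s : ℕ) :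
    factorSum u v (t + s) (annularCycle t s) = ∑ σ ∈ annularNC t s,
      prodOver u (cyclePartition σ) * prodOver v (cyclePartition (σ⁻¹ * annularCycle t s)) := by
  classical
  rw [factorSum, annularNC]
  simp only [cycleProd_eq_prodOver]
  refine Finset.sum_congr ?_ fun _ _ => rfl
  ext σ
  simp only [Finset.mem_filter, Finset.mem_univ, true_and]
  rw [isPretransitive_closure_iff, joint_of_mul_eq (mul_inv_cancel_left σ (annularCycle t s)),
    numCycles_eq_card_cyclePartition, numCycles_eq_card_cyclePartition]
  rfl

theorem parts_partition_finRotate {n : ℕ} (hn : 1 ≤ n) :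
    (finRotate n).partition.parts = {n} := by
  have : Nonempty (Fin n) := ⟨⟨0, hn⟩⟩
  rw [parts_eq_singleton_of_top sameCycle_finRotate, Fintype.card_fin]

theorem parts_partition_sumCongr {α β : Type*} [Fintype α] [DecidableEq α] [Fintype β]
    [DecidableEq β] (σ : Equiv.Perm α) (τ : Equiv.Perm β) :
    (Equiv.Perm.sumCongr σ τ).partition.parts = σ.partition.parts + τ.partition.parts := by
  let e₁ : α ≃ {x : α ⊕ β // x.isLeft = true} := Equiv.sumIsLeft.symm
  let e₂ : β ≃ {x : α ⊕ β // ¬ x.isLeft = true} :=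
    { toFun := fun b => ⟨Sum.inr b, by simp⟩
      invFun := fun x => match x with
        | ⟨Sum.inr b, _⟩ => b
        | ⟨Sum.inl _, h⟩ => (h rfl).elim
      left_inv := fun b => rfl
      right_inv := by
        rintro ⟨a | b, h⟩
        · exact (h rfl).elim
        · rfl }
  have h : Equiv.Perm.sumCongr σ τ
      = Equiv.Perm.subtypeCongr (p := fun x : α ⊕ β => x.isLeft = true)
        (e₁.permCongr σ) (e₂.permCongr τ) := by
    ext1 x
    rcases x with a | b
    · rw [Equiv.Perm.subtypeCongr.left_apply _ _ (by simp)]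
      rfl
    · rw [Equiv.Perm.subtypeCongr.right_apply _ _ (by simp)]
      rfl
  rw [h, parts_partition_subtypeCongr, parts_partition_permCongr, parts_partition_permCongr]

theorem parts_partition_annularCycle {t s : ℕ} (ht : 1 ≤ t) (hs : 1 ≤ s) :
    (annularCycle t s).partition.parts = {t, s} := by
  rw [annularCycle, parts_partition_permCongr]
  refine (parts_partition_sumCongr _ _).trans ?_
  rw [parts_partition_finRotate ht, parts_partition_finRotate hs]
  rfl

/-- The class-size formula is in terms of cycle types, which omit fixed points; the degree `t + s =
n` recovers them. -/
theorem parts_eq_iff_cycleType {n : ℕ} (c : Equiv.Perm (Fin n)) {t s : ℕ} (ht : 1 ≤ t) (hs : 1 ≤ s)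
    (hts : t + s = n) : c.partition.parts = {t, s} ↔
      c.cycleType = Multiset.filter (2 ≤ ·) {t, s} := by
  subst hts
  have h := parts_partition_annularCycle ht hs
  rw [← h, Equiv.Perm.filter_parts_partition_eq_cycleType, ← Equiv.Perm.isConj_iff_cycleType_eq,
    Equiv.Perm.partition_eq_of_isConj, Nat.Partition.ext_iff]

/-- The factor on the left is the order of the centraliser: rotations of the two cycles, and their
exchange when the lengths agree. The cases `t < 2` and `s < 2` are separate because fixed points are
absent from the cycle type. -/
theorem card_parts_eq_pair {n t s : ℕ} (ht : 1 ≤ t) (hs : 1 ≤ s) (hts : t + s = n) :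
    ((Finset.univ.filter fun c : Equiv.Perm (Fin n) => c.partition.parts = {t, s}).card : ℝ)
      * ((t : ℝ) * s * (if t = s then 2 else 1)) = n.factorial := by
  simp only [parts_eq_iff_cycleType _ ht hs hts]
  have h := Equiv.Perm.card_of_cycleType_mul_eq (Fin n) (Multiset.filter (2 ≤ ·) {t, s})
  rw [Fintype.card_fin] at h
  rcases Nat.lt_or_ge t 2 with h1 | h1 <;> rcases Nat.lt_or_ge s 2 with h2 | h2
  · obtain rfl : t = 1 := by omega
    obtain rfl : s = 1 := by omega
    subst hts
    have hm : Multiset.filter (2 ≤ ·) {1, 1} = 0 := by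
      simp [Multiset.insert_eq_cons, Multiset.filter_singleton]
    rw [hm] at h ⊢
    rw [if_pos (by simp)] at h
    rw [if_pos rfl, ← h]
    simp
  · obtain rfl : t = 1 := by omega
    have hm : Multiset.filter (2 ≤ ·) {1, s} = {s} := by
      simp [Multiset.insert_eq_cons, Multiset.filter_singleton, h2]
    rw [hm] at h ⊢
    rw [if_pos (by simp; omega)] at h
    rw [if_neg (by omega), ← h]
    simp [← hts]
  · obtain rfl : s = 1 := by omega
    have hm : Multiset.filter (2 ≤ ·) {t, 1} = {t} := by
      simp [Multiset.insert_eq_cons, Multiset.filter_singleton, h1]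
    rw [hm] at h ⊢
    rw [if_pos (by simp; omega)] at h
    rw [if_neg (by omega), ← h]
    simp [← hts]
  · have hm : Multiset.filter (2 ≤ ·) {t, s} = {t, s} := by
      simp [Multiset.insert_eq_cons, Multiset.filter_singleton, h1, h2]
    rw [hm] at h ⊢
    rw [if_pos (by simp; omega)] at h
    rw [← h]
    by_cases hts' : t = s
    · subst hts'
      simp [← hts, Multiset.insert_eq_cons]
    · have hts'' : s ≠ t := fun e => hts' e.symm
      simp [← hts, Multiset.insert_eq_cons, hts', hts'', Multiset.count_cons]

/-- For `t ≠ s` a class has `n!/(ts)` elements but is indexed by two ordered pairs; for `t = s` it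
has `n!/(2ts)` and one pair. Both cases give weight `n!/(2ts)` per ordered pair. -/
theorem sum_two_cycles {n : ℕ} (f : Equiv.Perm (Fin n) → ℝ) (A : ℕ × ℕ → ℝ)
    (hA : ∀ t s, 1 ≤ t → 1 ≤ s → t + s = n → ∀ c, c.partition.parts = {t, s} → f c = A (t, s)) :
    ∑ c ∈ Finset.univ.filter (fun c : Equiv.Perm (Fin n) => numCycles c = 2), f c
      = (n.factorial : ℝ) / 2 *
        ∑ ts ∈ (Finset.HasAntidiagonal.antidiagonal n).filter (fun ts => 1 ≤ ts.1 ∧ 1 ≤ ts.2),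
          A ts / ((ts.1 : ℝ) * (ts.2 : ℝ)) := by
  classical
  set P := (Finset.HasAntidiagonal.antidiagonal n).filter (fun ts => 1 ≤ ts.1 ∧ 1 ≤ ts.2) with hP
  have hmem : ∀ ts : ℕ × ℕ, ts ∈ P ↔ ts.1 + ts.2 = n ∧ 1 ≤ ts.1 ∧ 1 ≤ ts.2 := fun ts => by
    rw [hP, Finset.mem_filter, Finset.HasAntidiagonal.mem_antidiagonal]
  have h1 : ∀ c ∈ Finset.univ.filter (fun c : Equiv.Perm (Fin n) => numCycles c = 2), f c
      = ∑ ts ∈ P, if c.partition.parts = {ts.1, ts.2}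
          then A ts * ((if ts.1 = ts.2 then 2 else 1) / 2) else 0 := by
    intro c hc
    obtain ⟨a, b, hab⟩ := Multiset.card_eq_two.1 (Finset.mem_filter.1 hc).2
    have ha : 1 ≤ a := c.partition.parts_pos (by simp [hab])
    have hb : 1 ≤ b := c.partition.parts_pos (by simp [hab])
    have hn : a + b = n := by
      have := c.partition.parts_sum
      rw [hab, Fintype.card_fin] at this
      simpa using this
    have hpair : ∀ ts : ℕ × ℕ, ({a, b} : Multiset ℕ) = {ts.1, ts.2} ↔ ts = (a, b) ∨ ts = (b, a) := by
      rintro ⟨t, s⟩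
      constructor
      · intro h
        have e1 : a ∈ ({t, s} : Multiset ℕ) := by rw [← h]; simp
        have e2 := congrArg Multiset.sum h
        simp only [Multiset.insert_eq_cons, Multiset.mem_cons, Multiset.mem_singleton,
          Multiset.sum_cons, Multiset.sum_singleton, Prod.mk.injEq] at e1 e2 ⊢
        omega
      · rintro (h | h) <;> obtain ⟨rfl, rfl⟩ := Prod.mk.inj h
        · rfl
        · exact Multiset.pair_comm _ _
    rw [← Finset.sum_filter, hab]
    have hfil : P.filter (fun ts => ({a, b} : Multiset ℕ) = {ts.1, ts.2}) = {(a, b), (b, a)} := by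
      ext ts
      rw [Finset.mem_filter, hpair, hmem]
      simp only [Finset.mem_insert, Finset.mem_singleton]
      constructor
      · exact fun h => h.2
      · rintro (rfl | rfl)
        · exact ⟨⟨hn, ha, hb⟩, Or.inl rfl⟩
        · exact ⟨⟨by rw [add_comm]; exact hn, hb, ha⟩, Or.inr rfl⟩
    rw [hfil]
    have e1 := hA a b ha hb hn c hab
    have e2 := hA b a hb ha (by omega) c (by rw [hab, Multiset.pair_comm])
    by_cases hne : a = b
    · subst hne
      simp [e1]
    · rw [Finset.sum_pair (by simp [hne])]
      have hne' : b ≠ a := fun e => hne e.symm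
      simp only [if_neg hne, if_neg hne']
      rw [← e1, ← e2]
      ring
  rw [Finset.sum_congr rfl h1, Finset.sum_comm, Finset.mul_sum]
  refine Finset.sum_congr rfl fun ts hts => ?_
  obtain ⟨hsum, ht, hs⟩ := (hmem ts).1 hts
  have hcard := card_parts_eq_pair ht hs hsum
  rw [← Finset.sum_filter, Finset.sum_const, Finset.filter_filter, nsmul_eq_mul]
  rw [Finset.filter_congr (q := fun c : Equiv.Perm (Fin n) => c.partition.parts = {ts.1, ts.2})
    (fun c _ => ⟨fun h => h.2, fun h => ⟨by rw [numCycles, h]; rfl, h⟩⟩), ← hcard]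
  have ht' : (ts.1 : ℝ) ≠ 0 := by positivity
  have hs' : (ts.2 : ℝ) ≠ 0 := by positivity
  field_simp

open Classical in
-- The genus bound allows at most two cycles for the product and parity excludes one. The class-size
-- weight `n!/2` equals `(n - 1)! * (n/2)`.
theorem sum_genus_zero_annulus (u v : ℕ → ℝ) {n : ℕ} (hn : 1 ≤ n) :
    ∑ q ∈ Finset.univ.filter (fun q : Equiv.Perm (Fin n) × Equiv.Perm (Fin n) =>
        joint q = ⊤ ∧ numCycles q.1 + numCycles q.2 = n), cycleProd u q.1 * cycleProd v q.2
      = ((n - 1).factorial : ℝ) * annularSum u v n := by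
  have : Nonempty (Fin n) := ⟨⟨0, hn⟩⟩
  have h := sum_two_cycles (n := n) (factorSum u v n)
    (fun ts => ∑ σ ∈ annularNC ts.1 ts.2, prodOver u (cyclePartition σ) *
      prodOver v (cyclePartition (σ⁻¹ * annularCycle ts.1 ts.2))) (by
    intro t s ht hs hts c hc
    subst hts
    rw [← factorSum_annularCycle]
    exact factorSum_congr_of_parts u v _ (hc.trans (parts_partition_annularCycle ht hs).symm))
  rw [sum_transitive_eq_sum_factorSum, annularSum, ← Finset.sum_subset (Finset.subset_univ
    (Finset.univ.filter (fun c : Equiv.Perm (Fin n) => numCycles c = 2))), h]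
  · simp only [Finset.sum_div]
    obtain ⟨m, rfl⟩ : ∃ m, n = m + 1 := ⟨n - 1, by omega⟩
    rw [Nat.factorial_succ, Nat.add_sub_cancel]
    push_cast
    ring
  · intro c _ hc
    refine factorSum_eq_zero u v _ fun h1 h2 => hc ?_
    rw [Fintype.card_fin] at h1 h2
    have := numCycles_pos c
    simp only [Finset.mem_filter, Finset.mem_univ, true_and]
    omega


/-! ### First-order expansions in `1/d` -/

/-- `f d = f₀ + f₁ / d + o(1/d)`. -/
def HasExpansion (f : ℕ → ℝ) (f₀ f₁ : ℝ) : Prop :=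
  Tendsto (fun d : ℕ => (d : ℝ) * (f d - f₀)) atTop (𝓝 f₁)

namespace HasExpansion

variable {f g : ℕ → ℝ} {f₀ f₁ g₀ g₁ : ℝ}

theorem congr' (h : HasExpansion f f₀ f₁) (e : f =ᶠ[atTop] g) : HasExpansion g f₀ f₁ :=
  Tendsto.congr' (e.mono fun d hd => by rw [hd]) h

theorem tendsto (h : HasExpansion f f₀ f₁) : Tendsto f atTop (𝓝 f₀) := by
  have h1 := (tendsto_inv_atTop_nhds_zero_nat (𝕜 := ℝ)).mul h
  rw [zero_mul] at h1
  have h2 : Tendsto (fun d => f d - f₀) atTop (𝓝 0) := by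
    refine h1.congr' ?_
    filter_upwards [eventually_ne_atTop 0] with d hd
    have : (d : ℝ) ≠ 0 := Nat.cast_ne_zero.2 hd
    field_simp
  simpa using h2.add_const f₀

theorem unique (h : HasExpansion f f₀ f₁) (h' : HasExpansion f g₀ g₁) : f₀ = g₀ ∧ f₁ = g₁ := by
  have e := tendsto_nhds_unique h.tendsto h'.tendsto
  subst e
  exact ⟨rfl, tendsto_nhds_unique h h'⟩

theorem const (c : ℝ) : HasExpansion (fun _ => c) c 0 := by
  simp [HasExpansion]

theorem add (hf : HasExpansion f f₀ f₁) (hg : HasExpansion g g₀ g₁) :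
    HasExpansion (fun d => f d + g d) (f₀ + g₀) (f₁ + g₁) :=
  (Tendsto.add hf hg).congr fun d => by ring

theorem sub (hf : HasExpansion f f₀ f₁) (hg : HasExpansion g g₀ g₁) :
    HasExpansion (fun d => f d - g d) (f₀ - g₀) (f₁ - g₁) :=
  (Tendsto.sub hf hg).congr fun d => by ring

theorem mul (hf : HasExpansion f f₀ f₁) (hg : HasExpansion g g₀ g₁) :
    HasExpansion (fun d => f d * g d) (f₀ * g₀) (f₁ * g₀ + f₀ * g₁) :=
  ((Tendsto.mul hf hg.tendsto).add (Tendsto.const_mul f₀ hg)).congr fun d => by ring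

/-- Existence suffices: when the moments are inverted, the leading coefficients are identified
afterwards by uniqueness. -/
theorem div (hf : HasExpansion f f₀ f₁) (hg : HasExpansion g g₀ g₁) (h0 : g₀ ≠ 0) :
    ∃ k₀ k₁, HasExpansion (fun d => f d / g d) k₀ k₁ := by
  refine ⟨f₀ / g₀, (f₁ * g₀ - f₀ * g₁) / (g₀ * g₀), ?_⟩
  have h1 : Tendsto (fun d => g d * g₀) atTop (𝓝 (g₀ * g₀)) := hg.tendsto.mul_const g₀
  refine ((Tendsto.sub (Tendsto.mul_const g₀ hf) (Tendsto.const_mul f₀ hg)).div h1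
    (mul_ne_zero h0 h0)).congr' ?_
  filter_upwards [hg.tendsto.eventually_ne h0] with d hd
  rw [Pi.div_apply]
  field_simp
  ring

theorem sum {ι : Type*} {s : Finset ι} {F : ι → ℕ → ℝ} {F₀ F₁ : ι → ℝ}
    (h : ∀ i ∈ s, HasExpansion (F i) (F₀ i) (F₁ i)) :
    HasExpansion (fun d => ∑ i ∈ s, F i d) (∑ i ∈ s, F₀ i) (∑ i ∈ s, F₁ i) :=
  (tendsto_finsetSum s h).congr fun d => by rw [← Finset.sum_sub_distrib, Finset.mul_sum]

theorem prod {ι : Type*} [DecidableEq ι] {s : Finset ι} {F : ι → ℕ → ℝ} {F₀ F₁ : ι → ℝ}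
    (h : ∀ i ∈ s, HasExpansion (F i) (F₀ i) (F₁ i)) :
    HasExpansion (fun d => ∏ i ∈ s, F i d) (∏ i ∈ s, F₀ i)
      (∑ i ∈ s, F₁ i * ∏ j ∈ s.erase i, F₀ j) := by
  induction s using Finset.induction with
  | empty => simpa using const 1
  | insert a s ha ih =>
    have h1 := (h a (Finset.mem_insert_self a s)).mul
      (ih fun i hi => h i (Finset.mem_insert_of_mem hi))
    simp only [Finset.prod_insert ha, Finset.sum_insert ha, Finset.erase_insert ha]
    convert h1 using 2
    rw [Finset.mul_sum]
    refine Finset.sum_congr rfl fun i hi => ?_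
    have hia : a ≠ i := fun e => ha (e ▸ hi)
    rw [Finset.erase_insert_of_ne hia, Finset.prod_insert fun h' => ha (Finset.mem_of_mem_erase h')]
    ring

theorem neg_inv_pow (k : ℕ) : HasExpansion (fun d => (-1 / (d : ℝ)) ^ k)
    (if k = 0 then 1 else 0) (if k = 1 then -1 else 0) := by
  have h1 : HasExpansion (fun d => -1 / (d : ℝ)) 0 (-1) := by
    refine tendsto_const_nhds.congr' ?_
    filter_upwards [eventually_ne_atTop 0] with d hd
    have : (d : ℝ) ≠ 0 := Nat.cast_ne_zero.2 hd
    field_simp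
    simp
  induction k with
  | zero => simpa using const 1
  | succ k ih =>
    have h2 := ih.mul h1
    simp only [pow_succ]
    convert h2 using 1
    · simp
    · by_cases hk : k = 0 <;> simp [hk]

theorem isLittleO_iff :
    (fun d : ℕ => f d - (f₀ + f₁ / (d : ℝ))) =o[atTop] (fun d : ℕ => 1 / (d : ℝ))
      ↔ HasExpansion f f₀ f₁ := by
  rw [Asymptotics.isLittleO_iff_tendsto', HasExpansion, ← tendsto_sub_nhds_zero_iff (x := f₁)]
  · refine tendsto_congr' ?_
    filter_upwards [eventually_ne_atTop 0] with d hd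
    have : (d : ℝ) ≠ 0 := Nat.cast_ne_zero.2 hd
    field_simp
    ring
  · filter_upwards [eventually_ne_atTop 0] with d hd h
    simp [hd] at h

theorem prodOver {n : ℕ} {x : ℕ → ℕ → ℝ} {u u' : ℕ → ℝ} {π : SetPartition n}
    (h : ∀ V ∈ π.parts, HasExpansion (fun d => x d V.card) (u V.card) (u' V.card)) :
    HasExpansion (fun d => prodOver (x d) π) (prodOver u π) (derivOver u u' π) := by
  classical
  exact HasExpansion.prod h

end HasExpansion

/-! ### Expansions of cumulants under products, and their inversion -/

theorem card_pos_of_mem_parts {n : ℕ} {π : SetPartition n} {V : Finset (Fin n)}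
    (hV : V ∈ π.parts) : 1 ≤ V.card :=
  Finset.card_pos.2 (π.nonempty_of_mem_parts hV)

/-- The product formula for cumulants and their fluctuations. -/
theorem hasExpansion_seqCumulant_mul {a b : ℕ → ℕ → ℝ} (ha : ∀ᶠ d in atTop, a d 0 = 1)
    (hb : ∀ᶠ d in atTop, b d 0 = 1) {u u' v v' : ℕ → ℝ}
    (hu : ∀ k, 1 ≤ k → HasExpansion (fun d => seqCumulant d (a d) k) (u k) (u' k))
    (hv : ∀ k, 1 ≤ k → HasExpansion (fun d => seqCumulant d (b d) k) (v k) (v' k))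
    {n : ℕ} (hn : 1 ≤ n) :
    HasExpansion (fun d => seqCumulant d (fun k => a d k * b d k) n)
      (∑ π ∈ NC n, prodOver u π * prodOver v (kreweras π)) (mulFluctuation u u' v v' n) := by
  classical
  have : Nonempty (Fin n) := ⟨⟨0, hn⟩⟩
  set x : ℕ → ℕ → ℝ := fun d => seqCumulant d (a d) with hx
  set y : ℕ → ℕ → ℝ := fun d => seqCumulant d (b d) with hy
  have hpu : ∀ π : SetPartition n,
      HasExpansion (fun d => prodOver (x d) π) (prodOver u π) (derivOver u u' π) :=
    fun π => HasExpansion.prodOver fun V hV => hu _ (card_pos_of_mem_parts hV)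
  have hpv : ∀ π : SetPartition n,
      HasExpansion (fun d => prodOver (y d) π) (prodOver v π) (derivOver v v' π) :=
    fun π => HasExpansion.prodOver fun V hV => hv _ (card_pos_of_mem_parts hV)
  have hf : ((n - 1).factorial : ℝ) ≠ 0 := Nat.cast_ne_zero.2 (Nat.factorial_ne_zero _)
  set term : ℕ → Equiv.Perm (Fin n) × Equiv.Perm (Fin n) → ℝ := fun d q =>
    (-1 / (d : ℝ)) ^ (n + 1 - numCycles q.1 - numCycles q.2) *
      (cycleProd (x d) q.1 * cycleProd (y d) q.2) with hterm
  have hT : ∀ q : Equiv.Perm (Fin n) × Equiv.Perm (Fin n), HasExpansion (fun d => cycleProd (x d) q.1 * cycleProd (y d) q.2)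
      (cycleProd u q.1 * cycleProd v q.2)
      (derivOver u u' (cyclePartition q.1) * prodOver v (cyclePartition q.2) +
        prodOver u (cyclePartition q.1) * derivOver v v' (cyclePartition q.2)) := by
    intro q
    simp only [cycleProd_eq_prodOver]
    exact (hpu _).mul (hpv _)
  -- Separation by the power of `-1/d`: the disc terms have power `0`, the annular ones power `1`,
  -- and the rest at least `2`.
  have hsplit : ∀ d, ∑ q ∈ Finset.univ.filter
      (fun q : Equiv.Perm (Fin n) × Equiv.Perm (Fin n) => joint q = ⊤), term d q
      = ((n - 1).factorial : ℝ) * (∑ π ∈ NC n, prodOver (x d) π * prodOver (y d) (kreweras π))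
      + ∑ q ∈ Finset.univ.filter (fun q : Equiv.Perm (Fin n) × Equiv.Perm (Fin n) =>
          joint q = ⊤ ∧ numCycles q.1 + numCycles q.2 = n), term d q
      + ∑ q ∈ Finset.univ.filter (fun q : Equiv.Perm (Fin n) × Equiv.Perm (Fin n) =>
          joint q = ⊤ ∧ numCycles q.1 + numCycles q.2 < n), term d q := by
    intro d
    rw [← sum_genus_zero_disc _ _ hn]
    have e : ∑ q ∈ Finset.univ.filter (fun q : Equiv.Perm (Fin n) × Equiv.Perm (Fin n) =>
        joint q = ⊤ ∧ numCycles q.1 + numCycles q.2 = n + 1),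
          cycleProd (x d) q.1 * cycleProd (y d) q.2
        = ∑ q ∈ Finset.univ.filter (fun q : Equiv.Perm (Fin n) × Equiv.Perm (Fin n) =>
        joint q = ⊤ ∧ numCycles q.1 + numCycles q.2 = n + 1), term d q := by
      refine Finset.sum_congr rfl fun q hq => ?_
      have := (Finset.mem_filter.1 hq).2.2
      simp only [hterm]
      rw [show n + 1 - numCycles q.1 - numCycles q.2 = 0 by omega, pow_zero, one_mul]
    rw [e]
    simp only [Finset.sum_filter, ← Finset.sum_add_distrib]
    refine Finset.sum_congr rfl fun q _ => ?_
    by_cases hj : joint q = ⊤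
    · have h1 := numCycles_add_le_of_transitive (σ := q.1) (τ := q.2) hj
      have h2 := numCycles_pos (q.1 * q.2)
      rw [Fintype.card_fin] at h1
      simp only [hj, true_and, if_true]
      rcases lt_trichotomy (numCycles q.1 + numCycles q.2) n with h | h | h
      · rw [if_neg (by omega), if_neg (by omega), if_pos h]; ring
      · rw [if_neg (by omega), if_pos h, if_neg (by omega)]; ring
      · rw [if_pos (by omega), if_neg (by omega), if_neg (by omega)]; ring
    · simp [hj]
  have h1 : HasExpansion (fun d => ∑ π ∈ NC n, prodOver (x d) π * prodOver (y d) (kreweras π))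
      (∑ π ∈ NC n, prodOver u π * prodOver v (kreweras π))
      (∑ π ∈ NC n, (derivOver u u' π * prodOver v (kreweras π)
        + prodOver u π * derivOver v v' (kreweras π))) :=
    HasExpansion.sum fun π _ => (hpu π).mul (hpv (kreweras π))
  have h2 : HasExpansion (fun d => ∑ q ∈ Finset.univ.filter
      (fun q : Equiv.Perm (Fin n) × Equiv.Perm (Fin n) =>
          joint q = ⊤ ∧ numCycles q.1 + numCycles q.2 = n), term d q) 0
      (-(((n - 1).factorial : ℝ) * annularSum u v n)) := by
    have := HasExpansion.sum (s := Finset.univ.filter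
      (fun q : Equiv.Perm (Fin n) × Equiv.Perm (Fin n) =>
          joint q = ⊤ ∧ numCycles q.1 + numCycles q.2 = n)) (F := fun q d => term d q)
          (F₀ := fun _ => 0) (F₁ := fun q => -(cycleProd u q.1 * cycleProd v q.2)) (by
      intro q hq
      have hq' := (Finset.mem_filter.1 hq).2.2
      have hE := (HasExpansion.neg_inv_pow (n + 1 - numCycles q.1 - numCycles q.2)).mul (hT q)
      rw [if_neg (by omega), if_pos (by omega)] at hE
      simpa using hE)
    simpa [Finset.sum_neg_distrib, sum_genus_zero_annulus u v hn] using this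
  have h3 : HasExpansion (fun d => ∑ q ∈ Finset.univ.filter
      (fun q : Equiv.Perm (Fin n) × Equiv.Perm (Fin n) =>
          joint q = ⊤ ∧ numCycles q.1 + numCycles q.2 < n), term d q) 0 0 := by
    have := HasExpansion.sum (s := Finset.univ.filter
      (fun q : Equiv.Perm (Fin n) × Equiv.Perm (Fin n) =>
          joint q = ⊤ ∧ numCycles q.1 + numCycles q.2 < n)) (F := fun q d => term d q)
          (F₀ := fun _ => 0) (F₁ := fun q => 0) (by
      intro q hq
      have hq' := (Finset.mem_filter.1 hq).2.2
      have hE := (HasExpansion.neg_inv_pow (n + 1 - numCycles q.1 - numCycles q.2)).mul (hT q)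
      rw [if_neg (by omega), if_neg (by omega)] at hE
      simpa using hE)
    simpa using this
  have h4 := (HasExpansion.const (1 / ((n - 1).factorial : ℝ))).mul
    ((((HasExpansion.const ((n - 1).factorial : ℝ)).mul h1).add h2).add h3)
  have h5 := h4.congr' (g := fun d => seqCumulant d (fun k => a d k * b d k) n) (by
    filter_upwards [ha, hb, eventually_ne_atTop 0] with d hd1 hd2 hd
    rw [seqCumulant_mul hd hd1 hd2 hn, hsplit d])
  convert h5 using 1
  · field_simp
    ring
  · rw [mulFluctuation]
    field_simp
    ring

/-- If the products with sequences all of whose cumulants are `1` have cumulants with an expansion,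
so have the sequences themselves. -/
theorem exists_hasExpansion_of_mul {a b : ℕ → ℕ → ℝ} (ha : ∀ᶠ d in atTop, a d 0 = 1)
    (hb : ∀ᶠ d in atTop, b d 0 = 1)
    (hy : ∀ᶠ d in atTop, ∀ k, 1 ≤ k → seqCumulant d (b d) k = 1) {z₀ z₁ : ℕ → ℝ}
    (hz : ∀ k, 1 ≤ k → HasExpansion (fun d => seqCumulant d (fun k => a d k * b d k) k)
      (z₀ k) (z₁ k)) (n : ℕ) (hn : 1 ≤ n) :
    ∃ u₀ u₁, HasExpansion (fun d => seqCumulant d (a d) n) u₀ u₁ := by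
  classical
  induction n using Nat.strong_induction_on with
  | _ n ih =>
    have : Nonempty (Fin n) := ⟨⟨0, hn⟩⟩
    have ih' : ∀ m, ∃ u : ℝ × ℝ, 1 ≤ m → m < n →
        HasExpansion (fun d => seqCumulant d (a d) m) u.1 u.2 := by
      intro m
      by_cases h : 1 ≤ m ∧ m < n
      · obtain ⟨u₀, u₁, hu⟩ := ih m h.2 h.1
        exact ⟨(u₀, u₁), fun _ _ => hu⟩
      · exact ⟨0, fun h1 h2 => (h ⟨h1, h2⟩).elim⟩
    choose u hu using ih'
    set S := Finset.univ.filter (fun q : Equiv.Perm (Fin n) × Equiv.Perm (Fin n) => joint q = ⊤)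
    set e : Equiv.Perm (Fin n) × Equiv.Perm (Fin n) → ℕ :=
      fun q => n + 1 - numCycles q.1 - numCycles q.2 with he
    -- The genus expansion is split by whether `q.1` is an `n`-cycle. This sum is the coefficient of
    -- the `n`-th cumulant of `a`; the complementary one below involves only blocks smaller than
    -- `n`, known by induction.
    have hB' := (HasExpansion.const (1 / ((n - 1).factorial : ℝ))).mul
      (HasExpansion.sum (s := S.filter (fun q => Equiv.Perm.SameCycle.setoid q.1 = ⊤))
        fun q _ => HasExpansion.neg_inv_pow (e q))
    have hR' := (HasExpansion.const (1 / ((n - 1).factorial : ℝ))).mul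
      (HasExpansion.sum (s := S.filter (fun q => ¬ Equiv.Perm.SameCycle.setoid q.1 = ⊤))
        (F := fun q d => (-1 / (d : ℝ)) ^ e q *
          prodOver (seqCumulant d (a d)) (cyclePartition q.1))
        fun q hq => (HasExpansion.neg_inv_pow (e q)).mul
          (HasExpansion.prodOver (u := fun k => (u k).1) (u' := fun k => (u k).2)
            fun V hV => hu _ (card_pos_of_mem_parts hV) (by
              have hne := (Finset.mem_filter.1 hq).2
              have hle := Finset.card_le_univ V
              rw [Fintype.card_fin] at hle
              refine lt_of_le_of_ne hle fun hc => hne ?_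
              have hVu : V = Finset.univ := Finset.eq_univ_of_card _ (by rw [hc, Fintype.card_fin])
              rw [eq_top_iff]
              intro s t _
              have : t ∈ (cyclePartition q.1).part s := by
                rw [(cyclePartition q.1).part_eq_of_mem hV (by rw [hVu]; simp), hVu]
                simp
              exact mem_cyclePartition_part.1 this)))
    -- This pair has `1 + n` cycles, hence exponent `0`, so the limit of the coefficient is
    -- positive.
    have hmem : ((finRotate n, 1) : Equiv.Perm (Fin n) × Equiv.Perm (Fin n)) ∈
        S.filter (fun q => Equiv.Perm.SameCycle.setoid q.1 = ⊤) := by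
      refine Finset.mem_filter.2 ⟨Finset.mem_filter.2 ⟨Finset.mem_univ _, ?_⟩, sameCycle_finRotate⟩
      rw [joint, sameCycle_finRotate, top_sup_eq]
    have hpos : 1 / ((n - 1).factorial : ℝ) *
        ∑ q ∈ S.filter (fun q => Equiv.Perm.SameCycle.setoid q.1 = ⊤),
          (if e q = 0 then (1 : ℝ) else 0) ≠ 0 := by
      refine mul_ne_zero (by positivity) (ne_of_gt (Finset.sum_pos' ?_ ⟨_, hmem, ?_⟩))
      · intro q _
        split_ifs <;> norm_num
      · have : e (finRotate n, 1) = 0 := by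
          simp [he, numCycles_finRotate, numCycles_one]
        rw [if_pos this]
        norm_num
    obtain ⟨k₀, k₁, hk⟩ := ((hz n hn).sub hR').div hB' hpos
    refine ⟨k₀, k₁, hk.congr' ?_⟩
    filter_upwards [ha, hb, hy, eventually_ne_atTop 0, hB'.tendsto.eventually_ne hpos]
      with d hd1 hd2 hd3 hd hd5
    rw [div_eq_iff hd5, seqCumulant_mul hd hd1 hd2 hn,
      ← Finset.sum_filter_add_sum_filter_not S (fun q => Equiv.Perm.SameCycle.setoid q.1 = ⊤)]
    have hone : ∀ q : Equiv.Perm (Fin n), cycleProd (seqCumulant d (b d)) q = 1 := by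
      intro q
      rw [cycleProd, Multiset.map_congr rfl fun k hk => hd3 k (q.partition.parts_pos hk)]
      simp
    have e1 : ∑ q ∈ S.filter (fun q => Equiv.Perm.SameCycle.setoid q.1 = ⊤),
        (-1 / (d : ℝ)) ^ (n + 1 - numCycles q.1 - numCycles q.2) *
          (cycleProd (seqCumulant d (a d)) q.1 * cycleProd (seqCumulant d (b d)) q.2)
        = seqCumulant d (a d) n *
          ∑ q ∈ S.filter (fun q => Equiv.Perm.SameCycle.setoid q.1 = ⊤), (-1 / (d : ℝ)) ^ e q := by
      rw [Finset.mul_sum]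
      refine Finset.sum_congr rfl fun q hq => ?_
      rw [hone, cycleProd, parts_eq_singleton_of_top (Finset.mem_filter.1 hq).2]
      simp [he, mul_comm]
    rw [e1]
    simp only [hone, mul_one, cycleProd_eq_prodOver]
    ring

/-! ### Newton's identities -/

/-- Newton's identity for indeterminates, evaluated at the elements of `s` in some order. -/
theorem succ_mul_esymm {R : Type*} [CommRing R] (s : Multiset R) (n : ℕ) :
    ((n + 1 : ℕ) : R) * s.esymm (n + 1) = ∑ k ∈ Finset.range (n + 1),
      (-1) ^ k * (s.map fun z => z ^ (k + 1)).sum * s.esymm (n - k) := by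
  rw [← Multiset.coe_toList s]
  generalize s.toList = l
  have hl : Finset.univ.val.map l.get = (l : Multiset R) := by
    rw [Fin.univ_val_map, List.ofFn_get]
  have hp : ∀ k, MvPolynomial.aeval l.get (MvPolynomial.psum (Fin l.length) R k)
      = ((l : Multiset R).map fun z => z ^ k).sum := by
    intro k
    rw [← hl, Multiset.map_map, MvPolynomial.psum, map_sum]
    simp only [map_pow, MvPolynomial.aeval_X]
    rfl
  have h := congrArg (MvPolynomial.aeval l.get)
    (MvPolynomial.mul_esymm_eq_sum (Fin l.length) R (n + 1))
  simp only [map_mul, map_sum, map_pow, map_neg, map_one, map_natCast, hp,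
    MvPolynomial.aeval_esymm_eq_multiset_esymm, hl] at h
  refine h.trans ?_
  rw [Finset.mul_sum]
  symm
  refine Finset.sum_bij (fun k _ => (n - k, k + 1)) ?_ ?_ ?_ ?_
  · intro k hk
    rw [Finset.mem_range] at hk
    simp only [Finset.mem_filter, Finset.HasAntidiagonal.mem_antidiagonal]
    omega
  · intro k _ k' _ e
    simpa using (Prod.mk.inj e).2
  · rintro ⟨i, j⟩ hij
    simp only [Finset.mem_filter, Finset.HasAntidiagonal.mem_antidiagonal] at hij
    refine ⟨j - 1, by simp; omega, ?_⟩
    ext <;> simp <;> omega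
  · intro k hk
    rw [Finset.mem_range] at hk
    obtain ⟨j, rfl⟩ := Nat.exists_eq_add_of_le (Nat.lt_succ_iff.1 hk)
    rw [Nat.add_sub_cancel_left]
    have : (-1 : R) ^ (k + j + 1 + 1) * (-1) ^ j = (-1) ^ k := by
      rw [← pow_add, show k + j + 1 + 1 + j = k + 2 * (j + 1) by ring, pow_add, pow_mul]
      simp
    rw [← this]
    simp only
    ring

/-! ### The sequence with all cumulants equal to one, and moments as cumulants -/

/-- The normalised coefficients `d (d-1) ⋯ (d-k+1) / d^k`, all of whose finite free cumulants
are `1`. -/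
noncomputable def laguerreSeq (d k : ℕ) : ℝ := (d.descFactorial k : ℝ) / (d : ℝ) ^ k

theorem laguerreSeq_zero (d : ℕ) : laguerreSeq d 0 = 1 := by simp [laguerreSeq]

theorem laguerreSeq_succ {d : ℕ} (hd : d ≠ 0) (k : ℕ) :
    laguerreSeq d (k + 1) = laguerreSeq d k * (1 + (k : ℝ) * (-1 / (d : ℝ))) := by
  have hd' : (d : ℝ) ≠ 0 := Nat.cast_ne_zero.2 hd
  rw [laguerreSeq, laguerreSeq, Nat.descFactorial_succ]
  rcases Nat.lt_or_ge d k with h | h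
  · rw [Nat.descFactorial_eq_zero_iff_lt.2 h]
    simp
  · push_cast [h]
    field_simp
    ring

/-- The generating series is `(1 + z/d)^d = exp (d log (1 + z/d))`. -/
theorem isExpSeq_laguerreSeq {d : ℕ} (hd : d ≠ 0) :
    IsExpSeq (laguerreSeq d) (fun k => ((k - 1).factorial : ℝ) * (-1 / (d : ℝ)) ^ (k - 1)) := by
  intro n
  induction n with
  | zero => simp [laguerreSeq_succ hd, laguerreSeq_zero]
  | succ n ih =>
    -- The term `k = 0` gives `laguerreSeq d (n + 1)`; the others reproduce the previous recursion
    -- times `(n + 1) * (-1/d)`.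
    rw [Finset.sum_range_succ', laguerreSeq_succ hd (n + 1)]
    have e : ∀ k ∈ Finset.range (n + 1), ((n + 1).choose (k + 1) : ℝ) *
        (((k + 1 + 1 - 1).factorial : ℝ) * (-1 / (d : ℝ)) ^ (k + 1 + 1 - 1)) *
          laguerreSeq d (n + 1 - (k + 1))
        = ((n + 1 : ℕ) : ℝ) * (-1 / (d : ℝ)) * ((n.choose k : ℝ) *
        (((k + 1 - 1).factorial : ℝ) * (-1 / (d : ℝ)) ^ (k + 1 - 1)) * laguerreSeq d (n - k)) := by
      intro k _
      have hc : ((n + 1 : ℕ) : ℝ) * (n.choose k : ℝ)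
          = ((n + 1).choose (k + 1) : ℝ) * ((k + 1 : ℕ) : ℝ) := by
        exact_mod_cast Nat.add_one_mul_choose_eq n k
      simp only [Nat.add_sub_cancel, Nat.add_sub_add_right, Nat.factorial_succ, pow_succ]
      push_cast at hc ⊢
      linear_combination (-((k.factorial : ℝ) * (-1 / (d : ℝ)) ^ k * (-1 / (d : ℝ)) *
        laguerreSeq d (n - k))) * hc
    rw [Finset.sum_congr rfl e, ← Finset.mul_sum, ← ih]
    simp
    ring

theorem seqCumulant_laguerreSeq {d : ℕ} (hd : d ≠ 0) {k : ℕ} (hk : 1 ≤ k) :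
    seqCumulant d (laguerreSeq d) k = 1 := by
  have hd' : (d : ℝ) ≠ 0 := Nat.cast_ne_zero.2 hd
  have hf : ((k - 1).factorial : ℝ) ≠ 0 := Nat.cast_ne_zero.2 (Nat.factorial_ne_zero _)
  rw [seqCumulant_eq_of_isExpSeq d (laguerreSeq_zero d) (isExpSeq_laguerreSeq hd) hk]
  have e : (-(d : ℝ)) ^ (k - 1) * (-1 / (d : ℝ)) ^ (k - 1) = 1 := by
    rw [← mul_pow]
    field_simp
    simp
  field_simp
  rwa [neg_div] at e

theorem normCoeff_of_lt {d k : ℕ} (p : ℝ[X]) (h : d < k) : normCoeff d p k = 0 := by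
  rw [normCoeff, Nat.choose_eq_zero_of_lt h]
  simp

theorem normCoeff_zero {d : ℕ} {p : ℝ[X]} (hp : p.Monic) (hd : p.natDegree = d) :
    normCoeff d p 0 = 1 := by
  simp [normCoeff, ← hd, hp]

/-- By Vieta the normalised coefficient is `e_k / (d choose k)`, and the other factor is `k! (d
choose k) / d^k`, so the binomials cancel. For `k > d` both sides vanish. -/
theorem normCoeff_mul_laguerreSeq {d : ℕ} {p : ℝ[X]} (hp : p.Monic)
    (hdeg : p.natDegree = d) (k : ℕ) :
    ((normCoeff d p k * laguerreSeq d k : ℝ) : ℂ)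
      = (k.factorial : ℂ) / (d : ℂ) ^ k * (p.aroots ℂ).esymm k := by
  have hs : (p.aroots ℂ).card = d := by
    rw [aroots, IsAlgClosed.card_roots_eq_natDegree, hp.natDegree_map, hdeg]
  rcases Nat.lt_or_ge d k with h | h
  · rw [normCoeff_of_lt p h, Multiset.esymm, Multiset.powersetCard_eq_empty k (by omega)]
    simp
  · have hmap : (p.map (algebraMap ℝ ℂ)).natDegree = d := by rw [hp.natDegree_map, hdeg]
    have hv := Polynomial.coeff_eq_esymm_roots_of_card (p := p.map (algebraMap ℝ ℂ))
      (by rw [hmap]; exact hs) (k := d - k) (by rw [hmap]; omega)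
    rw [hmap, (hp.map _).leadingCoeff, one_mul, Nat.sub_sub_self h, coeff_map] at hv
    have hc : (d.choose k : ℂ) ≠ 0 := Nat.cast_ne_zero.2 (Nat.choose_pos h).ne'
    have hsq : ((-1 : ℂ) ^ k) * (-1) ^ k = 1 := by rw [← mul_pow]; simp
    rw [normCoeff, laguerreSeq, Nat.descFactorial_eq_factorial_mul_choose]
    push_cast
    rw [show ((p.coeff (d - k) : ℝ) : ℂ) = algebraMap ℝ ℂ (p.coeff (d - k)) from rfl, hv, aroots,
      ← mul_assoc, hsq]
    field_simp

/-- The moments of the root distribution are the cumulants of the product with `laguerreSeq`. -/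
theorem rootMoment_eq_seqCumulant {d : ℕ} (hd : d ≠ 0) {p : ℝ[X]} (hp : p.Monic)
    (hdeg : p.natDegree = d) {n : ℕ} (hn : 1 ≤ n) :
    rootMoment d p n = seqCumulant d (fun k => normCoeff d p k * laguerreSeq d k) n := by
  have hd' : (d : ℝ) ≠ 0 := Nat.cast_ne_zero.2 hd
  have hdC : (d : ℂ) ≠ 0 := Nat.cast_ne_zero.2 hd
  set P : ℕ → ℝ := fun k => ((p.aroots ℂ).map (fun z => z ^ k)).sum.re with hP
  have hPC : ∀ k, (P k : ℂ) = ((p.aroots ℂ).map (fun z => z ^ k)).sum := by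
    intro k
    rw [hP]
    apply Complex.ext
    · simp
    · rw [rootPowerSum_im]; simp
  -- The generating series is the product of the factors `1 + λ z/d` over the roots `λ`, and its
  -- logarithm has these power sums as coefficients. The recursion is Newton's identity, checked
  -- over `ℂ` because the roots need not be real.
  have hexp : IsExpSeq (fun k => normCoeff d p k * laguerreSeq d k)
      (fun k => ((k - 1).factorial : ℝ) * (-1) ^ (k - 1) * P k / (d : ℝ) ^ k) := by
    intro m
    have h := succ_mul_esymm (p.aroots ℂ) m
    apply Complex.ofReal_injective
    rw [Complex.ofReal_sum]
    simp only [Complex.ofReal_mul _ (normCoeff d p _ * laguerreSeq d _),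
      normCoeff_mul_laguerreSeq hp hdeg]
    rw [Nat.factorial_succ, Nat.cast_mul]
    calc _ = (m.factorial : ℂ) / (d : ℂ) ^ (m + 1)
          * (((m + 1 : ℕ) : ℂ) * (p.aroots ℂ).esymm (m + 1)) := by ring
      _ = _ := by
        rw [h, Finset.mul_sum]
        refine Finset.sum_congr rfl fun k hk => ?_
        have hk' : k ≤ m := Nat.lt_succ_iff.1 (Finset.mem_range.1 hk)
        have hc : (m.factorial : ℂ)
            = (m.choose k : ℂ) * (k.factorial : ℂ) * ((m - k).factorial : ℂ) := by
          exact_mod_cast (Nat.choose_mul_factorial_mul_factorial hk').symm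
        rw [hc, ← hPC]
        push_cast
        rw [show (d : ℂ) ^ (m + 1) = (d : ℂ) ^ (k + 1) * (d : ℂ) ^ (m - k) by
          rw [← pow_add]; congr 1; omega]
        field_simp
  have h0 : normCoeff d p 0 * laguerreSeq d 0 = 1 := by
    rw [normCoeff_zero hp hdeg, laguerreSeq_zero, one_mul]
  rw [seqCumulant_eq_of_isExpSeq d h0 hexp hn, rootMoment]
  obtain ⟨m, rfl⟩ : ∃ m, n = m + 1 := ⟨n - 1, by omega⟩
  have hf : (m.factorial : ℝ) ≠ 0 := Nat.cast_ne_zero.2 (Nat.factorial_ne_zero _)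
  have e : (-(d : ℝ)) ^ m * (-1) ^ m = (d : ℝ) ^ m := by rw [← mul_pow]; simp
  simp only [Nat.add_sub_cancel]
  field_simp
  linear_combination (-(P (m + 1) * (d : ℝ))) * e

/-! ### Coefficients of the convolution and transfer between moments and cumulants -/

theorem mulConv_coeff (d : ℕ) (p q : ℝ[X]) {k : ℕ} (hk : k ≤ d) :
    (mulConv d p q).coeff (d - k)
      = (-1) ^ k * (d.choose k : ℝ) * (normCoeff d p k * normCoeff d q k) := by
  rw [mulConv, finsetSum_coeff, Finset.sum_eq_single k]
  · rw [coeff_C_mul, coeff_X_pow, if_pos rfl, mul_one]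
  · intro j hj hjk
    have : j < d + 1 := Finset.mem_range.1 hj
    rw [coeff_C_mul, coeff_X_pow, if_neg (by omega), mul_zero]
  · intro h
    simp at h
    omega

theorem natDegree_mulConv_le (d : ℕ) (p q : ℝ[X]) : (mulConv d p q).natDegree ≤ d :=
  natDegree_sum_le_of_forall_le _ _ fun k _ =>
    (natDegree_C_mul_X_pow_le _ _).trans (Nat.sub_le d k)

theorem normCoeff_mulConv (d : ℕ) (p q : ℝ[X]) (k : ℕ) :
    normCoeff d (mulConv d p q) k = normCoeff d p k * normCoeff d q k := by
  rcases Nat.lt_or_ge d k with h | h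
  · rw [normCoeff_of_lt _ h, normCoeff_of_lt _ h, zero_mul]
  · rw [normCoeff, mulConv_coeff d p q h]
    have hc : (d.choose k : ℝ) ≠ 0 := Nat.cast_ne_zero.2 (Nat.choose_pos h).ne'
    have hsq : ((-1 : ℝ) ^ k) * (-1) ^ k = 1 := by rw [← mul_pow]; simp
    rw [div_eq_iff hc]
    linear_combination (d.choose k : ℝ) * (normCoeff d p k * normCoeff d q k) * hsq

theorem coeff_mulConv_self {d : ℕ} {p q : ℝ[X]} (hp : p.Monic) (hpd : p.natDegree = d)
    (hq : q.Monic) (hqd : q.natDegree = d) : (mulConv d p q).coeff d = 1 := by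
  have := mulConv_coeff d p q (Nat.zero_le d)
  simpa [normCoeff_zero hp hpd, normCoeff_zero hq hqd] using this

theorem monic_mulConv {d : ℕ} {p q : ℝ[X]} (hp : p.Monic) (hpd : p.natDegree = d)
    (hq : q.Monic) (hqd : q.natDegree = d) :
    (mulConv d p q).Monic ∧ (mulConv d p q).natDegree = d := by
  have h := coeff_mulConv_self hp hpd hq hqd
  exact ⟨monic_of_natDegree_le_of_coeff_eq_one d (natDegree_mulConv_le d p q) h,
    natDegree_eq_of_le_of_coeff_ne_zero (natDegree_mulConv_le d p q) (by rw [h]; norm_num)⟩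

theorem prodOver_congr {u v : ℕ → ℝ} (h : ∀ k, 1 ≤ k → u k = v k) {n : ℕ} (π : SetPartition n) :
    prodOver u π = prodOver v π :=
  Finset.prod_congr rfl fun _ hV => h _ (card_pos_of_mem_parts hV)

theorem prodOver_one {n : ℕ} (π : SetPartition n) : prodOver (fun _ => 1) π = 1 := by
  simp [prodOver]

theorem mulFluctuation_one (u u' : ℕ → ℝ) (n : ℕ) :
    mulFluctuation u u' (fun _ => 1) (fun _ => 0) n = infinitesimalMoment u u' n := by
  simp [mulFluctuation, infinitesimalMoment, prodOver_one, derivOver]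

/-- From an expansion of the cumulants to an expansion of the moments. -/
theorem hasExpansion_rootMoment {p : ℕ → ℝ[X]}
    (hp : ∀ d, 1 ≤ d → (p d).Monic ∧ (p d).natDegree = d) {u u' : ℕ → ℝ}
    (hu : ∀ k, 1 ≤ k → HasExpansion (fun d => finiteCumulant d (p d) k) (u k) (u' k))
    {n : ℕ} (hn : 1 ≤ n) :
    HasExpansion (fun d => rootMoment d (p d) n) (∑ π ∈ NC n, prodOver u π)
      (infinitesimalMoment u u' n) := by
  -- The cumulants of the second factor are identically `1`, so its fluctuations are `0`.
  have h := hasExpansion_seqCumulant_mul (a := fun d => normCoeff d (p d)) (b := laguerreSeq)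
    (by filter_upwards [eventually_ge_atTop 1] with d hd using normCoeff_zero (hp d hd).1 (hp d hd).2)
    (Eventually.of_forall laguerreSeq_zero) hu (v := fun _ => 1) (v' := fun _ => 0)
    (fun k hk => (HasExpansion.const 1).congr' (by
      filter_upwards [eventually_ge_atTop 1] with d hd
      rw [seqCumulant_laguerreSeq (by omega) hk])) hn
  rw [mulFluctuation_one] at h
  simp only [prodOver_one, mul_one] at h
  refine h.congr' ?_
  filter_upwards [eventually_ge_atTop 1] with d hd
  rw [rootMoment_eq_seqCumulant (by omega) (hp d hd).1 (hp d hd).2 hn]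

/-- From an expansion of the moments to an expansion of the cumulants. -/
theorem exists_hasExpansion_finiteCumulant {p : ℕ → ℝ[X]}
    (hp : ∀ d, 1 ≤ d → (p d).Monic ∧ (p d).natDegree = d) {m m' : ℕ → ℝ}
    (hm : ∀ k, 1 ≤ k → HasExpansion (fun d => rootMoment d (p d) k) (m k) (m' k)) :
    ∃ r : ℕ → ℝ, ∀ n, 1 ≤ n →
      HasExpansion (fun d => finiteCumulant d (p d) n) (freeCumulant m n) (r n) := by
  have h := exists_hasExpansion_of_mul (a := fun d => normCoeff d (p d)) (b := laguerreSeq)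
    (by filter_upwards [eventually_ge_atTop 1] with d hd using normCoeff_zero (hp d hd).1 (hp d hd).2)
    (Eventually.of_forall laguerreSeq_zero)
    (by filter_upwards [eventually_ge_atTop 1] with d hd k hk using
      seqCumulant_laguerreSeq (by omega) hk)
    (z₀ := m) (z₁ := m')
    (fun k hk => (hm k hk).congr' (by
      filter_upwards [eventually_ge_atTop 1] with d hd
      rw [rootMoment_eq_seqCumulant (by omega) (hp d hd).1 (hp d hd).2 hk]))
  have h' : ∀ n, ∃ u₀ u₁, 1 ≤ n → HasExpansion (fun d => finiteCumulant d (p d) n) u₀ u₁ := by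
    intro n
    by_cases hn : 1 ≤ n
    · obtain ⟨u₀, u₁, hu⟩ := h n hn
      exact ⟨u₀, u₁, fun _ => hu⟩
    · exact ⟨0, 0, fun h => (hn h).elim⟩
  choose u u' hu using h'
  -- The limits of the cumulants satisfy the moment-cumulant formula, because limits of moments are
  -- unique; hence they are the free cumulants.
  have hfree := freeCumulant_unique m u fun n hn =>
    ((hm n hn).unique (hasExpansion_rootMoment hp hu hn)).1
  exact ⟨u', fun n hn => by rw [← hfree n hn]; exact hu n hn⟩

/-- The linear functional on polynomials with given values on the monomials. -/
noncomputable def functionalOfMoments (c : ℕ → ℝ) : ℝ[X] →ₗ[ℝ] ℝ :=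
  (Polynomial.basisMonomials ℝ).constr ℝ c

theorem functionalOfMoments_X_pow (c : ℕ → ℝ) (n : ℕ) : functionalOfMoments c (X ^ n) = c n := by
  have := (Polynomial.basisMonomials ℝ).constr_basis ℝ c n
  simp only [coe_basisMonomials, monomial_one_right_eq_X_pow] at this
  exact this

theorem rootMoment_zero {d : ℕ} (hd : 1 ≤ d) {p : ℝ[X]} (hp : p.Monic) (hdeg : p.natDegree = d) :
    rootMoment d p 0 = 1 := by
  have hs : (p.aroots ℂ).card = d := by
    rw [aroots, IsAlgClosed.card_roots_eq_natDegree, hp.natDegree_map, hdeg]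
  have hd' : (d : ℝ) ≠ 0 := Nat.cast_ne_zero.2 (by omega)
  simp [rootMoment, hs, hd']

end FiniteFree

/-! ### The main theorem -/

theorem mainTheorem2 (p q : ℕ → Polynomial ℝ)
    (hp : ∀ d, 1 ≤ d → FiniteFree.IsRealRooted d (p d))
    (hq : ∀ d, 1 ≤ d → FiniteFree.IsRealRooted d (q d))
    (μ ν : MeasureTheory.Measure ℝ) (μ' ν' : Polynomial ℝ →ₗ[ℝ] ℝ)
    (hμ : FiniteFree.HasInfinitesimalDistribution p μ μ')
    (hν : FiniteFree.HasInfinitesimalDistribution q ν ν') :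
    -- `rp`, `rq`, `rpq`: cumulant fluctuations of the two sequences and of their product;
    -- `mpq`: infinitesimal moments of the product (all unique for indices `n ≥ 1`)
    ∃ rp rq rpq mpq : ℕ → ℝ,
      FiniteFree.HasCumulantFluctuations p (FiniteFree.moments μ) rp ∧
      FiniteFree.HasCumulantFluctuations q (FiniteFree.moments ν) rq ∧
      (∀ n : ℕ, 1 ≤ n → rpq n =
        FiniteFree.mulFluctuation
          (FiniteFree.freeCumulant (FiniteFree.moments μ)) rp
          (FiniteFree.freeCumulant (FiniteFree.moments ν)) rq n) ∧
      (∀ n : ℕ, 1 ≤ n → mpq n =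
        FiniteFree.infinitesimalMoment
          (FiniteFree.freeCumulant
            (FiniteFree.freeMulConv (FiniteFree.moments μ) (FiniteFree.moments ν))) rpq n) ∧
      -- the expansions of the product, relative to the moment sequence of `μ ⊠ ν`
      FiniteFree.HasCumulantFluctuations (fun d => FiniteFree.mulConv d (p d) (q d))
        (FiniteFree.freeMulConv (FiniteFree.moments μ) (FiniteFree.moments ν)) rpq ∧
      (∀ n : ℕ, 1 ≤ n →
        Filter.Tendsto
          (fun d : ℕ =>
            (d : ℝ) * (FiniteFree.rootMoment d (FiniteFree.mulConv d (p d) (q d)) n -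
              FiniteFree.freeMulConv (FiniteFree.moments μ) (FiniteFree.moments ν) n))
          Filter.atTop (nhds (mpq n))) ∧
      -- the same relative to a probability measure `τ = μ ⊠ ν`
      (∀ τ : MeasureTheory.Measure ℝ, FiniteFree.IsFreeMulConv μ ν τ →
        FiniteFree.HasCumulantFluctuations
          (fun d => FiniteFree.mulConv d (p d) (q d)) (FiniteFree.moments τ) rpq ∧
        ∃ τ' : Polynomial ℝ →ₗ[ℝ] ℝ,
          FiniteFree.HasInfinitesimalDistribution
            (fun d => FiniteFree.mulConv d (p d) (q d)) τ τ' ∧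
          ∀ n : ℕ, 1 ≤ n → τ' (Polynomial.X ^ n) = mpq n) := by
  open FiniteFree in
  have hp' : ∀ d, 1 ≤ d → (p d).Monic ∧ (p d).natDegree = d :=
    fun d hd => ⟨(hp d hd).1, (hp d hd).2.1⟩
  have hq' : ∀ d, 1 ≤ d → (q d).Monic ∧ (q d).natDegree = d :=
    fun d hd => ⟨(hq d hd).1, (hq d hd).2.1⟩
  have hpq : ∀ d, 1 ≤ d →
      (mulConv d (p d) (q d)).Monic ∧ (mulConv d (p d) (q d)).natDegree = d :=
    fun d hd => monic_mulConv (hp' d hd).1 (hp' d hd).2 (hq' d hd).1 (hq' d hd).2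
  obtain ⟨rp, hrp⟩ := exists_hasExpansion_finiteCumulant hp' fun k _ => hμ.infinitesimal k
  obtain ⟨rq, hrq⟩ := exists_hasExpansion_finiteCumulant hq' fun k _ => hν.infinitesimal k
  set m := moments μ
  set k := moments ν
  set rpq : ℕ → ℝ := mulFluctuation (freeCumulant m) rp (freeCumulant k) rq with hrpq
  set mpq : ℕ → ℝ := infinitesimalMoment (freeCumulant (freeMulConv m k)) rpq with hmpq
  have hcum : ∀ n, 1 ≤ n → HasExpansion (fun d => finiteCumulant d (mulConv d (p d) (q d)) n)
      (freeCumulant (freeMulConv m k) n) (rpq n) := by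
    intro n hn
    rw [freeCumulant_freeMulConv m k hn]
    have h := hasExpansion_seqCumulant_mul (a := fun d => normCoeff d (p d))
      (b := fun d => normCoeff d (q d))
      (by filter_upwards [Filter.eventually_ge_atTop 1] with d hd using
        normCoeff_zero (hp' d hd).1 (hp' d hd).2)
      (by filter_upwards [Filter.eventually_ge_atTop 1] with d hd using
        normCoeff_zero (hq' d hd).1 (hq' d hd).2) hrp hrq hn
    refine h.congr' (Filter.Eventually.of_forall fun d => ?_)
    simp only [finiteCumulant_eq_seqCumulant, ← normCoeff_mulConv]
  have hmom : ∀ n, 1 ≤ n → HasExpansion (fun d => rootMoment d (mulConv d (p d) (q d)) n)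
      (freeMulConv m k n) (mpq n) := by
    intro n hn
    rw [moment_eq_sum_freeCumulant (freeMulConv m k) hn]
    exact hasExpansion_rootMoment hpq hcum hn
  refine ⟨rp, rq, rpq, mpq, fun n hn => HasExpansion.isLittleO_iff.2 (hrp n hn),
    fun n hn => HasExpansion.isLittleO_iff.2 (hrq n hn), fun _ _ => rfl, fun _ _ => rfl,
    fun n hn => HasExpansion.isLittleO_iff.2 (hcum n hn), hmom, ?_⟩
  rintro τ ⟨hτ, hτr⟩
  have hr : ∀ n, 1 ≤ n → freeCumulant (moments τ) n = freeCumulant (freeMulConv m k) n :=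
    fun n hn => by rw [hτr n hn, freeCumulant_freeMulConv m k hn]
  have hmτ : ∀ n, 1 ≤ n → moments τ n = freeMulConv m k n := by
    intro n hn
    rw [moment_eq_sum_freeCumulant (moments τ) hn,
      moment_eq_sum_freeCumulant (freeMulConv m k) hn]
    exact Finset.sum_congr rfl fun π _ => prodOver_congr hr π
  -- The functional takes the value `0` at degree `0`: for `d ≥ 1` the zeroth moments of the
  -- polynomial and of `τ` are both `1`.
  refine ⟨fun n hn => HasExpansion.isLittleO_iff.2 (by rw [hr n hn]; exact hcum n hn),
    functionalOfMoments fun n => if n = 0 then 0 else mpq n, ?_, fun n hn => by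
      rw [functionalOfMoments_X_pow, if_neg (by omega)]⟩
  have hexp : ∀ n, HasExpansion (fun d => rootMoment d (mulConv d (p d) (q d)) n) (moments τ n)
      (if n = 0 then 0 else mpq n) := by
    intro n
    rcases Nat.eq_zero_or_pos n with rfl | hn
    · have := hτ.1
      rw [if_pos rfl]
      refine (HasExpansion.const (moments τ 0)).congr' ?_
      filter_upwards [Filter.eventually_ge_atTop 1] with d hd
      rw [rootMoment_zero hd (hpq d hd).1 (hpq d hd).2]
      simp [moments]
    · rw [if_neg (by omega), hmτ n hn]
      exact hmom n hn
  exact ⟨hτ, fun n => (hexp n).tendsto, fun n => by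
    rw [functionalOfMoments_X_pow]; exact hexp n⟩
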